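/- Let $N\ge 3$ be an integer and $\gamma\in(0,\pi)$. Let $\mathcal D_\gamma=\{x\in S^{N-1} : x_N=\cos\theta_1 \text{ with } 0\le\theta_1<\gamma\}$ be the open spherical cap of the unit sphere $S^{N-1}\subset\mathbb R^N$ whose points make an angle less than $\gamma$ with the positive $x_N$-axis, and let $\lambda_1(\gamma)$ be the first (smallest) Dirichlet eigenvalue of the spherical Laplacian $-\Delta_{S^{N-1}}$ on $\mathcal D_\gamma$, that is, the smallest $\lambda\in\mathbb R$ for which there is a nonzero $u\in H^1_0(\mathcal D_\gamma)$ with $$\int_{\mathcal D_\gamma}\nabla_{S^{N-1}}u\cdot\nabla_{S^{N-1}}\psi\,d\sigma=\lambda\int_{\mathcal D_\gamma}u\,\psi\,d\sigma\qquad\text{for all }\psi\in C_c^\infty(\mathcal D_\gamma).$$ Let $B_1$ be the smallest positive zero of the Bessel function of the first kind $J_{(N-3)/2}$. Both $\lambda_1(\gamma)$ and $B_1$ exist, and $$\Big(\frac{\sin\gamma}{\gamma}\Big)^{N-2}\Big(\frac{B_1}{\gamma}\Big)^2\le\lambda_1(\gamma)\le\Big(\frac{\gamma}{\sin\gamma}\Big)^{N-2}\Big(\frac{B_1}{\gamma}\Big)^2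 .$$ -/

import Mathlib

open MeasureTheory Filter Topology
open scoped ContDiff

noncomputable section

namespace SphereDirichlet

/-- The Euclidean space `ℝ^N`. -/
abbrev Space (N : ℕ) : Type := EuclideanSpace ℝ (Fin N)

/-- The unit sphere `S^{N-1}` of `ℝ^N`. -/
abbrev Sphere (N : ℕ) : Type := Metric.sphere (0 : Space N) 1

/-- The surface measure on `S^{N-1}`. -/
def surface (N : ℕ) : Measure (Sphere N) :=
  (volume : Measure (Space N)).toSphere

/-- The gradient on the sphere, at `x`, of the restriction to `S^{N-1}` of a function `φ` on `ℝ^N`: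
the component of the Euclidean gradient that is tangent to the sphere. It depends only on the
values of `φ` on the sphere. -/
def sphereGrad {N : ℕ} (φ : Space N → ℝ) (x : Sphere N) : Space N :=
  gradient φ (x : Space N) - inner ℝ (x : Space N) (gradient φ (x : Space N)) • (x : Space N)

/-- Elements of `C_c^∞(D)`, `D ⊆ S^{N-1}`. The smooth functions on the sphere are the restrictions
of the smooth functions on `ℝ^N`; the support is taken in the (compact) sphere. -/
def IsTest {N : ℕ} (D : Set (Sphere N)) (φ : Space N → ℝ) : Prop :=
  ContDiff ℝ ∞ φ ∧ tsupport (fun x : Sphere N => φ x) ⊆ D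

/-- `u` belongs to `H^1_0(D)`, the closure of `C_c^∞(D)` in `H^1(S^{N-1})`, and `G` is its weak
gradient. -/
def MemH10 {N : ℕ} (D : Set (Sphere N)) (u : Sphere N → ℝ) (G : Sphere N → Space N) : Prop :=
  MemLp u 2 (surface N) ∧ MemLp G 2 (surface N) ∧
    ∃ φ : ℕ → Space N → ℝ, (∀ n, IsTest D (φ n)) ∧
      Tendsto (fun n => eLpNorm (fun x : Sphere N => φ n x - u x) 2 (surface N)) atTop (𝓝 0) ∧
      Tendsto (fun n => eLpNorm (fun x : Sphere N => sphereGrad (φ n) x - G x) 2 (surface N))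
        atTop (𝓝 0)

/-- `l` is a Dirichlet eigenvalue of the spherical Laplacian on `D`: there is a nonzero
`u ∈ H^1_0(D)` with `-Δ u = l u` weakly in `D`. -/
def IsDirichletEigenvalue {N : ℕ} (D : Set (Sphere N)) (l : ℝ) : Prop :=
  ∃ (u : Sphere N → ℝ) (G : Sphere N → Space N), MemH10 D u G ∧ ¬ (u =ᵐ[surface N] 0) ∧
    ∀ ψ : Space N → ℝ, IsTest D ψ →
      ∫ x, inner ℝ (G x) (sphereGrad ψ x) ∂(surface N) = l * ∫ x, u x * ψ x ∂(surface N)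

/-- `l` is the first (smallest) Dirichlet eigenvalue of the spherical Laplacian on `D`. -/
def IsFirstDirichletEigenvalue {N : ℕ} (D : Set (Sphere N)) (l : ℝ) : Prop :=
  IsLeast {m : ℝ | IsDirichletEigenvalue D m} l

/-- The open geodesic ball of `S^{N-1}` with centre `e` and radius `γ`. -/
def cap {N : ℕ} (e : Space N) (γ : ℝ) : Set (Sphere N) :=
  {x | InnerProductGeometry.angle e (x : Space N) < γ}

/-- The Bessel function of the first kind `J_ν(x)`, for `x > 0` and real order `ν ≥ 0`. -/
def besselJ (ν x : ℝ) : ℝ :=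
  ∑' k : ℕ, (-1 : ℝ) ^ k / ((k.factorial : ℝ) * Real.Gamma (k + ν + 1)) *
    (x / 2) ^ (2 * (k : ℝ) + ν)

/-- `B` is the first positive zero of `J_ν`. -/
def IsFirstBesselZero (ν B : ℝ) : Prop :=
  IsLeast {x : ℝ | 0 < x ∧ besselJ ν x = 0} B

end SphereDirichlet

end

namespace SphereDirichlet

/-! ### Power series with coefficients given by a two-term recursion -/

/-! Put M = N - 2. A function w of the polar angle θ alone solves the eigenvalue equation on the
sphere when (sin^M θ · w')' = -l sin^M θ · w. On a flat ball of dimension N - 1 the weight is r^M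
instead; there the solution regular at the centre is, up to a power of r, the Bessel function of
order (N - 3)/2, and its first zero falls at γ exactly for the eigenvalue μ = (B/γ)². Since sine is
concave, c r^M ≤ sin^M r ≤ r^M on [0, γ] with c = (sin γ/γ)^M, and the Sturm–Picone comparison
`sturm_picone` squeezes the radial eigenvalue of the cap between cμ and μ/c.

That eigenvalue is found without spectral theory. In s = (1 - cos θ)/2 the solutions regular at the
pole are power series, jointly continuous in l and s. `exists_capProfile_first_zero` takes the least
l ≥ 0 whose solution fails to be positive on [0, γ]. By continuity in l this solution is
nonnegative, and a zero before γ would be a double zero, which the strictly decreasing flux sin^M θ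
· w' forbids. So it is positive before γ and vanishes at γ.

This l is the first Dirichlet eigenvalue. Cutting the solution off at small levels puts it in H¹₀,
and integration by parts gives the weak equation (`isDirichletEigenvalue_polarCap`). Conversely,
Picone's inequality against the positive solution bounds the Dirichlet form of test functions below
by l times the squared L² norm (`mul_integral_sq_le`), and density extends the bound to every
eigenfunction (`le_of_isDirichletEigenvalue`). Integration by parts on the sphere comes from the
Euclidean one, applied to functions homogeneous of degree 0 times a radial cutoff. -/

/-- The sum of the power series with coefficients `c`. -/
noncomputable def powerSum (c : ℕ → ℝ) (s : ℝ) : ℝ := ∑' k, c k * s ^ k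

/-- The coefficients of the derivative of a power series. -/
def shiftCoeff (c : ℕ → ℝ) (k : ℕ) : ℝ := (k + 1) * c (k + 1)

/-- The power series with coefficients `c` converges absolutely on `(-R, R)`. -/
def ConvergesOn (c : ℕ → ℝ) (R : ℝ) : Prop :=
  ∀ r, 0 < r → r < R → Summable fun k => |c k| * r ^ k

/-- Passing to a radius q strictly between r and R costs a factor k (r/q)^k, which is bounded. -/
theorem ConvergesOn.shiftCoeff {c : ℕ → ℝ} {R : ℝ} (hc : ConvergesOn c R) :
    ConvergesOn (shiftCoeff c) R := by
  intro r hr hrR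
  obtain ⟨q, hrq, hqR⟩ := exists_between hrR
  have hq : 0 < q := hr.trans hrq
  have hlt : r / q < 1 := (div_lt_one hq).2 hrq
  have hbdd := (tendsto_self_mul_const_pow_of_lt_one (div_nonneg hr.le hq.le) hlt).bddAbove_range
  obtain ⟨C, hC⟩ := hbdd
  have hs := ((summable_nat_add_iff 1).2 (hc q hq hqR)).mul_left (C / r)
  refine hs.of_nonneg_of_le (fun k => by positivity) fun k => ?_
  have hk : ((k + 1 : ℕ) : ℝ) * (r / q) ^ (k + 1) ≤ C := hC ⟨k + 1, rfl⟩
  rw [div_pow, ← mul_div_assoc, div_le_iff₀ (by positivity)] at hk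
  have : |SphereDirichlet.shiftCoeff c k| * r ^ k
      = |c (k + 1)| / r * (((k + 1 : ℕ) : ℝ) * r ^ (k + 1)) := by
    rw [SphereDirichlet.shiftCoeff, abs_mul, abs_of_nonneg (by positivity : (0 : ℝ) ≤ k + 1)]
    push_cast
    field_simp
    ring
  rw [this]
  calc |c (k + 1)| / r * (((k + 1 : ℕ) : ℝ) * r ^ (k + 1))
      ≤ |c (k + 1)| / r * (C * q ^ (k + 1)) := by gcongr
    _ = C / r * (|c (k + 1)| * q ^ (k + 1)) := by ring

theorem ConvergesOn.summable {c : ℕ → ℝ} {R s : ℝ} (hc : ConvergesOn c R) (hs : |s| < R) :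
    Summable fun k => c k * s ^ k := by
  obtain ⟨q, hsq, hqR⟩ := exists_between hs
  refine Summable.of_norm_bounded (hc q ((abs_nonneg s).trans_lt hsq) hqR) fun k => ?_
  rw [norm_mul, norm_pow, Real.norm_eq_abs, Real.norm_eq_abs]
  gcongr

theorem hasDerivAt_powerSum {c : ℕ → ℝ} {R s : ℝ} (hc : ConvergesOn c R) (hs : |s| < R) :
    HasDerivAt (powerSum c) (powerSum (shiftCoeff c) s) s := by
  obtain ⟨q, hsq, hqR⟩ := exists_between hs
  have hq : 0 < q := (abs_nonneg s).trans_lt hsq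
  have hu := hc.shiftCoeff q hq hqR
  have hu' : Summable fun k : ℕ => (k : ℝ) * |c k| * q ^ (k - 1) := by
    refine (summable_nat_add_iff 1).1 (hu.congr fun k => ?_)
    rw [SphereDirichlet.shiftCoeff, abs_mul, abs_of_nonneg (by positivity : (0 : ℝ) ≤ k + 1)]
    push_cast
    simp
  have h := hasDerivAt_tsum_of_isPreconnected (g := fun k y => c k * y ^ k)
    (g' := fun k y => c k * (k * y ^ (k - 1))) hu' (isOpen_Ioo (a := -q) (b := q))
    isPreconnected_Ioo (fun k y _ => (hasDerivAt_pow k y).const_mul (c k))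
    (fun k y hy => by
      rw [norm_mul, norm_mul, norm_pow, Real.norm_eq_abs, Real.norm_eq_abs, Real.norm_eq_abs,
        abs_of_nonneg (Nat.cast_nonneg k : (0 : ℝ) ≤ k)]
      have : |y| ≤ q := (abs_lt.2 hy).le
      calc |c k| * (k * |y| ^ (k - 1)) ≤ |c k| * (k * q ^ (k - 1)) := by gcongr
        _ = _ := by ring)
    (y₀ := s) (abs_lt.1 hsq) (hc.summable hs) (abs_lt.1 hsq)
  convert! h using 1
  have hsum : Summable fun k : ℕ => c k * (k * s ^ (k - 1)) := by
    refine Summable.of_norm_bounded hu' fun k => ?_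
    rw [norm_mul, norm_mul, norm_pow, Real.norm_eq_abs, Real.norm_eq_abs, Real.norm_eq_abs,
      abs_of_nonneg (Nat.cast_nonneg k : (0 : ℝ) ≤ k)]
    calc |c k| * (k * |s| ^ (k - 1)) ≤ |c k| * (k * q ^ (k - 1)) := by gcongr
      _ = _ := by ring
  rw [hsum.tsum_eq_zero_add]
  simp only [powerSum, SphereDirichlet.shiftCoeff]
  simp only [Nat.cast_zero, zero_mul, mul_zero, zero_add, Nat.add_sub_cancel, Nat.cast_add,
    Nat.cast_one]
  exact tsum_congr fun k => by ring

theorem contDiffOn_powerSum {c : ℕ → ℝ} {R : ℝ} (hc : ConvergesOn c R) :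
    ContDiffOn ℝ ∞ (powerSum c) (Set.Ioo (-R) R) := by
  rw [contDiffOn_infty]
  intro n
  induction n generalizing c with
  | zero =>
    refine contDiffOn_zero.2 fun s hs => ?_
    exact (hasDerivAt_powerSum hc (abs_lt.2 hs)).continuousAt.continuousWithinAt
  | succ n ih =>
    rw [Nat.cast_add, Nat.cast_one, contDiffOn_succ_iff_deriv_of_isOpen isOpen_Ioo]
    refine ⟨fun s hs => (hasDerivAt_powerSum hc
      (abs_lt.2 hs)).differentiableAt.differentiableWithinAt, by simp, ?_⟩
    exact (ih hc.shiftCoeff).congr fun s hs => (hasDerivAt_powerSum hc (abs_lt.2 hs)).deriv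

theorem mul_powerSum_shiftCoeff {c : ℕ → ℝ} {s : ℝ}
    (h : Summable fun k => shiftCoeff c k * s ^ k) :
    HasSum (fun k : ℕ => (k * c k) * s ^ k) (s * powerSum (shiftCoeff c) s) := by
  have h1 := h.hasSum.mul_left s
  rw [← hasSum_nat_add_iff' 1]
  convert! h1 using 1
  · ext k
    simp only [shiftCoeff]
    push_cast
    ring
  · simp [powerSum]

/-- The solution of `c₀ = 1`, `(k + 1) (k + a) cₖ₊₁ = (ε k (k + b) - l) cₖ`. -/
noncomputable def recCoeff (a ε b l : ℝ) : ℕ → ℝ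
  | 0 => 1
  | k + 1 => (ε * (k * (k + b)) - l) / ((k + 1) * (k + a)) * recCoeff a ε b l k

theorem recCoeff_succ {a : ℝ} (ha : 0 < a) (ε b l : ℝ) (k : ℕ) :
    (k + 1) * (k + a) * recCoeff a ε b l (k + 1) =
      (ε * (k * (k + b)) - l) * recCoeff a ε b l k := by
  have : (k : ℝ) + a ≠ 0 := by positivity
  rw [recCoeff]
  field_simp

/-- The ratio test then gives radius 1/ε: ε = 0 yields the entire Bessel series, ε = 1 the
hypergeometric series of the sphere, with radius 1. -/
theorem tendsto_recCoeff_ratio (a ε b l : ℝ) :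
    Tendsto (fun k : ℕ => (ε * (k * (k + b)) - l) / (((k : ℝ) + 1) * (k + a))) atTop (𝓝 ε) := by
  have h0 : Tendsto (fun k : ℕ => (1 : ℝ) / k) atTop (𝓝 0) := tendsto_one_div_atTop_nhds_zero_nat
  have h1 : Tendsto (fun k : ℕ => (ε * (1 + b * (1 / (k : ℝ))) - l * (1 / k) * (1 / k)) /
      ((1 + 1 / (k : ℝ)) * (1 + a * (1 / k)))) atTop (𝓝 ((ε * (1 + b * 0) - l * 0 * 0) /
      ((1 + 0) * (1 + a * 0)))) := by
    refine Tendsto.div ?_ ?_ (by norm_num)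
    · exact (((h0.const_mul b).const_add 1).const_mul ε).sub ((h0.const_mul l).mul h0)
    · exact (h0.const_add 1).mul ((h0.const_mul a).const_add 1)
  simp only [mul_zero, add_zero, mul_one, sub_zero, div_one] at h1
  refine h1.congr' ?_
  filter_upwards [eventually_gt_atTop 0] with k hk
  have hk : (0 : ℝ) < k := by exact_mod_cast hk
  have e1 : (ε * (k * (k + b)) - l) = k ^ 2 * (ε * (1 + b * (1 / (k : ℝ))) - l * (1 / k) * (1 / k))
      := by field_simp
  have e2 : ((k : ℝ) + 1) * (k + a) = k ^ 2 * ((1 + 1 / (k : ℝ)) * (1 + a * (1 / k))) := by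
    field_simp
  rw [e1, e2, mul_div_mul_left _ _ (by positivity)]

theorem convergesOn_recCoeff (a b l : ℝ) {ε R : ℝ} (hε : 0 ≤ ε) (hR : ε * R ≤ 1) :
    ConvergesOn (recCoeff a ε b l) R := by
  intro r hr hrR
  have hεr : ε * r < 1 := by
    rcases hε.eq_or_lt with rfl | hε
    · simp
    · exact (mul_lt_mul_of_pos_left hrR hε).trans_le hR
  obtain ⟨q, hq1, hq2⟩ := exists_between hεr
  have ht := ((tendsto_recCoeff_ratio a ε b l).abs.mul_const r)
  rw [abs_of_nonneg hε] at ht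
  refine summable_of_ratio_norm_eventually_le hq2 ?_
  filter_upwards [ht.eventually_lt_const hq1] with k hk
  simp only [recCoeff, norm_mul, Real.norm_eq_abs, abs_abs, abs_mul, pow_succ, abs_of_pos hr,
    abs_pow] at hk ⊢
  calc _ = (|(ε * (k * (k + b)) - l) / (((k : ℝ) + 1) * (k + a))| * r) *
        (|recCoeff a ε b l k| * r ^ k) := by ring
    _ ≤ _ := by gcongr

/-- The differential equation satisfied by the power series with coefficients `recCoeff`. -/
theorem powerSum_recCoeff_ode {a ε b l R s : ℝ} (ha : 0 < a) (hε : 0 ≤ ε) (hR : ε * R ≤ 1)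
    (hs : |s| < R) :
    s * powerSum (shiftCoeff (shiftCoeff (recCoeff a ε b l))) s +
        a * powerSum (shiftCoeff (recCoeff a ε b l)) s =
      ε * (s ^ 2 * powerSum (shiftCoeff (shiftCoeff (recCoeff a ε b l))) s +
        (1 + b) * (s * powerSum (shiftCoeff (recCoeff a ε b l)) s)) -
        l * powerSum (recCoeff a ε b l) s := by
  have hc := convergesOn_recCoeff a b l hε hR
  set c := recCoeff a ε b l with hcdef
  have h0 := (hc.summable hs).hasSum
  have h1 := (hc.shiftCoeff.summable hs).hasSum
  have h2 := mul_powerSum_shiftCoeff (hc.shiftCoeff.shiftCoeff.summable hs)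
  have h3 := mul_powerSum_shiftCoeff (hc.shiftCoeff.summable hs)
  have h4 : HasSum (fun k : ℕ => (k * ((k - 1) * c k)) * s ^ k)
      (s * (s * powerSum (shiftCoeff (shiftCoeff c)) s)) := by
    have e : shiftCoeff (fun k : ℕ => ((k : ℝ) - 1) * c k) = fun k : ℕ => k * shiftCoeff c k := by
      ext k
      simp only [shiftCoeff]
      push_cast
      ring
    have hsum : Summable fun k => shiftCoeff (fun k : ℕ => ((k : ℝ) - 1) * c k) k * s ^ k := by
      rw [e]; exact h2.summable
    have := mul_powerSum_shiftCoeff hsum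
    rw [e] at this
    convert! this using 2
    exact h2.tsum_eq.symm
  have hL := h2.add (h1.mul_left a)
  have hRR := ((h4.add (h3.mul_left (1 + b))).mul_left ε).sub (h0.mul_left l)
  have := hL.unique (hRR.congr_fun fun k => ?_)
  · simp only [powerSum] at this ⊢
    linear_combination this
  · have := recCoeff_succ ha ε b l k
    rw [← hcdef] at this
    simp only [shiftCoeff]
    linear_combination s ^ k * this

/-- With parameter -L every factor of the recursion is nonnegative and dominates the one for l, so a
single series majorizes all |l| ≤ L. -/
theorem abs_recCoeff_le {a b l L : ℝ} (ha : 0 < a) (hb : 0 ≤ b) (hl : |l| ≤ L) (k : ℕ) :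
    |recCoeff a 1 b l k| ≤ recCoeff a 1 b (-L) k := by
  induction k with
  | zero => simp [recCoeff]
  | succ k ih =>
    rw [recCoeff, recCoeff, abs_mul, abs_div,
      abs_of_pos (by positivity : 0 < ((k : ℝ) + 1) * (k + a))]
    have : |1 * (k * (k + b)) - l| ≤ 1 * (k * (k + b)) - -L := by
      have h : (0 : ℝ) ≤ k * (k + b) := by positivity
      rw [abs_le] at hl ⊢
      constructor <;> linarith
    have hL : (0 : ℝ) ≤ 1 * (k * (k + b)) - -L := (abs_nonneg _).trans this
    gcongr

theorem continuous_recCoeff (a ε b : ℝ) (k : ℕ) : Continuous fun l => recCoeff a ε b l k := by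
  induction k with
  | zero => exact continuous_const
  | succ k ih => simp only [recCoeff]; fun_prop

/-- Weierstrass test with the majorant at -L. Continuity jointly in the eigenvalue parameter and the
variable is what allows a least critical eigenvalue to be chosen by compactness. -/
theorem continuousOn_powerSum_recCoeff {a b L S : ℝ} (ha : 0 < a) (hb : 0 ≤ b) (hS0 : 0 < S)
    (hS : S < 1) :
    ContinuousOn (fun p : ℝ × ℝ => powerSum (recCoeff a 1 b p.1) p.2)
      (Set.Icc 0 L ×ˢ Set.Icc 0 S) := by
  have hsum := convergesOn_recCoeff a b (-L) zero_le_one (one_mul (1 : ℝ)).le S hS0 hS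
  refine continuousOn_tsum (fun k => ?_) hsum fun k p hp => ?_
  · exact (((continuous_recCoeff a 1 b k).comp continuous_fst).mul
      (continuous_snd.pow k)).continuousOn
  · rw [norm_mul, norm_pow, Real.norm_eq_abs, Real.norm_eq_abs, abs_of_nonneg hp.2.1]
    have h := (abs_recCoeff_le ha hb ((abs_of_nonneg hp.1.1).trans_le hp.1.2) k).trans
      (le_abs_self _)
    have := hp.2.1
    gcongr
    exact hp.2.2

@[simp]
theorem powerSum_zero (c : ℕ → ℝ) : powerSum c 0 = c 0 := by
  rw [powerSum, tsum_eq_single 0 fun k hk => by simp [hk]]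
  simp

/-! ### Sturm–Picone comparison -/

/-- This controls the Picone boundary term at γ. If w has a simple zero there, f²/w is f times a
quotient of difference slopes that stays bounded. -/
theorem tendsto_sq_div_nhdsLT {f w : ℝ → ℝ} {f' w' γ : ℝ} (hf : HasDerivAt f f' γ)
    (hw : HasDerivAt w w' γ) (hf0 : f γ = 0) (hwγ : 0 < w γ ∨ (w γ = 0 ∧ w' ≠ 0)) :
    Tendsto (fun x => f x ^ 2 / w x) (𝓝[<] γ) (𝓝 0) := by
  have hf1 : Tendsto f (𝓝[<] γ) (𝓝 0) := by
    rw [← hf0]; exact hf.continuousAt.tendsto.mono_left nhdsWithin_le_nhds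
  rcases hwγ with h | ⟨h0, h1⟩
  · have hw1 : Tendsto w (𝓝[<] γ) (𝓝 (w γ)) :=
      hw.continuousAt.tendsto.mono_left nhdsWithin_le_nhds
    have := (hf1.pow 2).div hw1 h.ne'
    rw [zero_pow two_ne_zero, zero_div] at this
    exact this
  · have hle : 𝓝[<] γ ≤ 𝓝[≠] γ := nhdsWithin_mono _ fun x hx => ne_of_lt hx
    have h2 := ((hasDerivAt_iff_tendsto_slope.1 hf).mono_left hle).div
      ((hasDerivAt_iff_tendsto_slope.1 hw).mono_left hle) h1
    have h3 := hf1.mul h2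
    rw [zero_mul] at h3
    refine h3.congr' ?_
    filter_upwards [self_mem_nhdsWithin] with x hx
    have hx' : x - γ ≠ 0 := sub_ne_zero.2 (ne_of_lt hx)
    simp only [Pi.div_apply, slope_def_field, hf0, h0, sub_zero]
    rw [div_div_div_cancel_right₀ hx']
    ring

/-- **Sturm–Picone comparison.** If the derivatives of `P w'` and `Q f'` on `(0, γ)` are `-a w` and
`-b f`, with `P ≤ Q` and `b < a`, if `P w'` and `Q f'` vanish at `0` and `f` vanishes at `γ`, then `w` cannot be positive on
`[0, γ)` (a double zero of `w` at `γ` being excluded). -/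
theorem sturm_picone {γ : ℝ} (hγ : 0 < γ) {P Q a b w f w' f' : ℝ → ℝ}
    (hP : ∀ x ∈ Set.Ioo 0 γ, 0 < P x) (hPQ : ∀ x ∈ Set.Ioo 0 γ, P x ≤ Q x)
    (hw : ∀ x ∈ Set.Icc 0 γ, HasDerivAt w (w' x) x)
    (hf : ∀ x ∈ Set.Icc 0 γ, HasDerivAt f (f' x) x)
    (hPw : ∀ x ∈ Set.Ioo 0 γ, HasDerivAt (fun y => P y * w' y) (-(a x * w x)) x)
    (hQf : ∀ x ∈ Set.Ioo 0 γ, HasDerivAt (fun y => Q y * f' y) (-(b x * f x)) x)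
    (hab : ∀ x ∈ Set.Ioo 0 γ, b x * f x ^ 2 < a x * f x ^ 2)
    (hPwc : ContinuousOn (fun y => P y * w' y) (Set.Icc 0 γ))
    (hQfc : ContinuousOn (fun y => Q y * f' y) (Set.Icc 0 γ))
    (hPw0 : P 0 * w' 0 = 0) (hQf0 : Q 0 * f' 0 = 0)
    (hwpos : ∀ x ∈ Set.Ico 0 γ, 0 < w x) (hwγ : 0 < w γ ∨ (w γ = 0 ∧ w' γ ≠ 0))
    (hfγ : f γ = 0) : False := by
  -- The Picone function: it is strictly increasing, yet it is 0 at the left end and tends to 0 at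
  -- γ, which is absurd.
  set H : ℝ → ℝ := fun x => f x * (Q x * f' x) - f x ^ 2 / w x * (P x * w' x) with hH
  have hwc : ContinuousOn w (Set.Icc 0 γ) := fun x hx => (hw x hx).continuousAt.continuousWithinAt
  have hfc : ContinuousOn f (Set.Icc 0 γ) := fun x hx => (hf x hx).continuousAt.continuousWithinAt
  have hmono : StrictMonoOn H (Set.Ico 0 γ) := by
    refine strictMonoOn_of_deriv_pos (convex_Ico 0 γ) ?_ fun x hx => ?_
    · have hsub : Set.Ico 0 γ ⊆ Set.Icc 0 γ := Set.Ico_subset_Icc_self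
      exact ((hfc.mono hsub).mul (hQfc.mono hsub)).sub ((((hfc.mono hsub).pow 2).div
        (hwc.mono hsub) fun x hx => (hwpos x hx).ne').mul (hPwc.mono hsub))
    · rw [interior_Ico] at hx
      have hx' := Set.Ioo_subset_Icc_self hx
      have hw0 : w x ≠ 0 := (hwpos x ⟨hx.1.le, hx.2⟩).ne'
      have hd : HasDerivAt H _ x := ((hf x hx').mul (hQf x hx)).sub
        (((((hf x hx').pow 2)).div (hw x hx') hw0).mul (hPw x hx))
      rw [hd.deriv]
      -- Picone's identity: each of the three terms on the right has a sign.
      have e : f' x * (Q x * f' x) + f x * -(b x * f x) -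
          (((2 : ℕ) * f x ^ (2 - 1) * f' x * w x - f x ^ 2 * w' x) / w x ^ 2 * (P x * w' x) +
            f x ^ 2 / w x * -(a x * w x)) =
          (Q x - P x) * f' x ^ 2 + P x * (f' x - f x * w' x / w x) ^ 2 +
            (a x * f x ^ 2 - b x * f x ^ 2) := by
        field_simp
        push_cast
        ring
      have h1 : 0 ≤ (Q x - P x) * f' x ^ 2 :=
        mul_nonneg (sub_nonneg.2 (hPQ x hx)) (sq_nonneg _)
      have h2 : 0 ≤ P x * (f' x - f x * w' x / w x) ^ 2 := mul_nonneg (hP x hx).le (sq_nonneg _)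
      have h3 := hab x hx
      simp only [Pi.pow_apply, Pi.div_apply] at e ⊢
      linarith
  have hlim : Tendsto H (𝓝[<] γ) (𝓝 0) := by
    have hle : 𝓝[<] γ ≤ 𝓝[Set.Icc 0 γ] γ := by
      rw [nhdsWithin_Icc_eq_nhdsLE hγ]
      exact nhdsWithin_mono _ Set.Iio_subset_Iic_self
    have hγm : γ ∈ Set.Icc 0 γ := ⟨hγ.le, le_rfl⟩
    have t1 := ((hfc γ hγm).tendsto.mono_left hle).mul ((hQfc γ hγm).tendsto.mono_left hle)
    have t2 := (tendsto_sq_div_nhdsLT (hf γ hγm) (hw γ hγm) hfγ hwγ).mul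
      ((hPwc γ hγm).tendsto.mono_left hle)
    have := t1.sub t2
    simpa [hfγ] using this
  have hH0 : H 0 = 0 := by simp [hH, hPw0, hQf0]
  have hmid : H 0 < H (γ / 2) := hmono ⟨le_rfl, hγ⟩ ⟨by linarith, by linarith⟩ (by linarith)
  have hge : H (γ / 2) ≤ 0 := by
    refine ge_of_tendsto hlim ?_
    filter_upwards [Ioo_mem_nhdsLT (show γ / 2 < γ by linarith)] with x hx
    exact (hmono ⟨by linarith, by linarith⟩ ⟨by linarith [hx.1], hx.2⟩ hx.1).le
  linarith

/-! ### The radial Dirichlet problem on a Euclidean ball -/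

/-- The entire function `∑ (-1)ᵏ sᵏ / (k! (a)ₖ)`. -/
noncomputable def besselProfile (a : ℝ) : ℝ → ℝ := powerSum (recCoeff a 0 0 1)

theorem besselProfile_zero (a : ℝ) : besselProfile a 0 = 1 := by
  simp [besselProfile, recCoeff]

theorem hasDerivAt_besselProfile (a s : ℝ) :
    HasDerivAt (besselProfile a) (powerSum (shiftCoeff (recCoeff a 0 0 1)) s) s :=
  hasDerivAt_powerSum (convergesOn_recCoeff a 0 1 le_rfl (by simp)) (lt_add_one |s|)

theorem hasDerivAt_deriv_besselProfile (a s : ℝ) :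
    HasDerivAt (powerSum (shiftCoeff (recCoeff a 0 0 1)))
      (powerSum (shiftCoeff (shiftCoeff (recCoeff a 0 0 1))) s) s :=
  hasDerivAt_powerSum (convergesOn_recCoeff a 0 1 le_rfl (by simp)).shiftCoeff (lt_add_one |s|)

theorem continuous_besselProfile (a : ℝ) : Continuous (besselProfile a) :=
  continuous_iff_continuousAt.2 fun s => (hasDerivAt_besselProfile a s).continuousAt

theorem recCoeff_eq_gamma {ν : ℝ} (hν : 0 ≤ ν) (k : ℕ) :
    recCoeff (ν + 1) 0 0 1 k =
      Real.Gamma (ν + 1) * ((-1) ^ k / (k.factorial * Real.Gamma (k + ν + 1))) := by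
  induction k with
  | zero =>
    have := (Real.Gamma_pos_of_pos (by linarith : 0 < ν + 1)).ne'
    simp [recCoeff, this]
  | succ k ih =>
    have h1 : (k : ℝ) + ν + 1 ≠ 0 := by positivity
    have h2 : Real.Gamma (k + ν + 1) ≠ 0 := (Real.Gamma_pos_of_pos (by positivity)).ne'
    rw [recCoeff, ih, show ((k + 1 : ℕ) : ℝ) + ν + 1 = (k + ν + 1) + 1 by push_cast; ring,
      Real.Gamma_add_one h1, Nat.factorial_succ]
    have h3 : (k : ℝ) + (ν + 1) ≠ 0 := by positivity
    push_cast
    field_simp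
    ring

/-- The coefficients of the profile are (-1)^k / (k! (ν+1)_k), and Γ(k+ν+1) = (ν+1)_k Γ(ν+1). Hence
the positive zeros of J_ν are those of the profile at x²/4. -/
theorem besselJ_eq {ν x : ℝ} (hν : 0 ≤ ν) (hx : 0 < x) :
    Real.Gamma (ν + 1) * besselJ ν x = (x / 2) ^ ν * besselProfile (ν + 1) (x ^ 2 / 4) := by
  rw [besselJ, besselProfile, powerSum, ← tsum_mul_left, ← tsum_mul_left]
  refine tsum_congr fun k => ?_
  rw [recCoeff_eq_gamma hν, Real.rpow_add (by positivity),
    show (2 * (k : ℝ)) = ((2 * k : ℕ) : ℝ) by push_cast; ring, Real.rpow_natCast, pow_mul]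
  ring

theorem besselJ_eq_zero_iff {ν x : ℝ} (hν : 0 ≤ ν) (hx : 0 < x) :
    besselJ ν x = 0 ↔ besselProfile (ν + 1) (x ^ 2 / 4) = 0 := by
  have h1 := (Real.Gamma_pos_of_pos (by linarith : 0 < ν + 1)).ne'
  have h2 : (x / 2) ^ ν ≠ 0 := (Real.rpow_pos_of_pos (by positivity) ν).ne'
  rw [← mul_right_inj' h1, besselJ_eq hν hx, mul_zero, mul_eq_zero, or_iff_right h2]

/-- The derivative of `r ↦ besselProfile a (μ r² / 4)`. -/
noncomputable def flatDeriv (a μ r : ℝ) : ℝ :=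
  powerSum (shiftCoeff (recCoeff a 0 0 1)) (μ * r ^ 2 / 4) * (μ * r / 2)

theorem hasDerivAt_flat (a μ r : ℝ) :
    HasDerivAt (fun r => besselProfile a (μ * r ^ 2 / 4)) (flatDeriv a μ r) r := by
  have h : HasDerivAt (fun r : ℝ => μ * r ^ 2 / 4) (μ * r / 2) r := by
    convert! ((hasDerivAt_pow 2 r).const_mul μ).div_const 4 using 1
    push_cast
    ring
  exact (hasDerivAt_besselProfile a _).comp r h

/-- The radial Helmholtz equation in dimension M + 1 in divergence form, obtained from s F'' + a F'
= -F with s = μ r²/4. -/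
theorem hasDerivAt_pow_mul_flatDeriv (M : ℕ) (μ r : ℝ) :
    HasDerivAt (fun r => r ^ M * flatDeriv ((M + 1) / 2) μ r)
      (-((μ * r ^ M) * besselProfile ((M + 1) / 2) (μ * r ^ 2 / 4))) r := by
  have h : HasDerivAt (fun r : ℝ => μ * r ^ 2 / 4) (μ * r / 2) r := by
    convert! ((hasDerivAt_pow 2 r).const_mul μ).div_const 4 using 1
    push_cast
    ring
  have h1 := (hasDerivAt_deriv_besselProfile ((M + 1) / 2) (μ * r ^ 2 / 4)).comp r h
  -- The factor r inside `flatDeriv` is absorbed into r^(M+1), whose derivative involves r^M and no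
  -- truncated exponent M - 1.
  have h2 := ((hasDerivAt_pow (M + 1) r).mul_const (μ / 2)).mul h1
  have hode := powerSum_recCoeff_ode (a := ((M : ℝ) + 1) / 2) (ε := 0) (b := 0) (l := 1)
    (s := μ * r ^ 2 / 4) (R := |μ * r ^ 2 / 4| + 1) (by positivity) le_rfl (by simp)
    (lt_add_one _)
  convert! h2 using 1
  · ext y
    simp only [flatDeriv, Pi.mul_apply, Function.comp_apply]
    ring
  · simp only [besselProfile, Function.comp_apply]
    push_cast
    linear_combination -(μ * r ^ M) * hode

theorem continuous_pow_mul_flatDeriv (M : ℕ) (μ : ℝ) :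
    Continuous fun r : ℝ => r ^ M * flatDeriv ((M + 1) / 2) μ r :=
  continuous_iff_continuousAt.2 fun r => (hasDerivAt_pow_mul_flatDeriv M μ r).continuousAt

/-- A profile positive everywhere would contradict Sturm–Picone against f = (1 - r²)² on the unit
ball. The square makes -(r^M f')'/f tend to -∞ at r = 1, so it stays below a constant times r^M. -/
theorem exists_besselProfile_nonpos (M : ℕ) :
    ∃ x : ℝ, 0 < x ∧ besselProfile ((M + 1) / 2) (x ^ 2 / 4) ≤ 0 := by
  by_contra! hpos
  -- With t = 1 - r², the comparison needs 4((M+3)t - 2) < μ t². For this μ the difference is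
  -- ((M+3)t - 2)² + 4.
  set μ : ℝ := (M + 3) ^ 2 with hμ
  have hpos' : ∀ r : ℝ, 0 ≤ r → 0 < besselProfile ((M + 1) / 2) (μ * r ^ 2 / 4) := by
    intro r hr
    rcases hr.eq_or_lt with rfl | hr
    · simp [besselProfile_zero]
    · have := hpos ((M + 3) * r) (by positivity)
      rwa [mul_pow] at this
  have hderiv : ∀ x : ℝ, HasDerivAt (fun r : ℝ => (1 - r ^ 2) ^ 2) (-(4 * x * (1 - x ^ 2))) x := by
    intro x
    convert! ((hasDerivAt_pow 2 x).const_sub 1).pow 2 using 1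
    push_cast
    ring
  have hderiv2 : ∀ x : ℝ, HasDerivAt (fun r : ℝ => r ^ M * -(4 * r * (1 - r ^ 2)))
      (-(4 * x ^ M * ((M + 1) - (M + 3) * x ^ 2))) x := by
    intro x
    convert! ((hasDerivAt_pow (M + 3) x).sub (hasDerivAt_pow (M + 1) x)).const_mul 4 using 1
    · ext r
      simp only [Pi.sub_apply]
      ring
    · rw [show M + 3 - 1 = M + 2 by omega, Nat.add_sub_cancel]
      push_cast
      ring
  refine sturm_picone one_pos (P := fun r => r ^ M) (Q := fun r => r ^ M)
    (a := fun r => μ * r ^ M) (b := fun r => 4 * r ^ M * ((M + 1) - (M + 3) * r ^ 2) /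
      (1 - r ^ 2) ^ 2) (fun x hx => pow_pos hx.1 M) (fun x _ => le_rfl)
    (fun x _ => hasDerivAt_flat _ μ x) (fun x _ => hderiv x)
    (fun x _ => hasDerivAt_pow_mul_flatDeriv M μ x) (fun x hx => ?_) (fun x hx => ?_)
    (continuous_pow_mul_flatDeriv M μ).continuousOn ?_ (by simp [flatDeriv]) (by simp)
    (fun x hx => hpos' x hx.1) (.inl (hpos' 1 zero_le_one)) (by norm_num)
  · have hx1 : (1 - x ^ 2) ≠ 0 := by
      have := hx.1; have := hx.2
      nlinarith
    convert! hderiv2 x using 1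
    field_simp
  · have hx1 : 0 < (1 - x ^ 2) := by
      have := hx.1; have := hx.2
      nlinarith
    have hxM : 0 < x ^ M := pow_pos hx.1 M
    have e : 4 * x ^ M * ((M + 1) - (M + 3) * x ^ 2) / (1 - x ^ 2) ^ 2 * ((1 - x ^ 2) ^ 2) ^ 2 =
        x ^ M * (1 - x ^ 2) ^ 2 * (4 * ((M + 1) - (M + 3) * x ^ 2)) := by
      field_simp
    rw [e, show μ * x ^ M * ((1 - x ^ 2) ^ 2) ^ 2 =
      x ^ M * (1 - x ^ 2) ^ 2 * (μ * (1 - x ^ 2) ^ 2) by ring]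
    refine mul_lt_mul_of_pos_left ?_ (by positivity)
    have := sq_nonneg ((M + 3) * (1 - x ^ 2) - 2)
    rw [hμ]
    nlinarith
  · exact Continuous.continuousOn (by fun_prop)

theorem exists_isFirstBesselZero (M : ℕ) (hM : 1 ≤ M) :
    ∃ B, 0 < B ∧ IsFirstBesselZero ((M - 1) / 2) B ∧ besselProfile ((M + 1) / 2) (B ^ 2 / 4) = 0 ∧
      ∀ x, 0 ≤ x → x < B → 0 < besselProfile ((M + 1) / 2) (x ^ 2 / 4) := by
  have hM' : (1 : ℝ) ≤ M := by exact_mod_cast hM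
  have hν : (0 : ℝ) ≤ (M - 1) / 2 := by linarith
  have ha : ((M : ℝ) - 1) / 2 + 1 = (M + 1) / 2 := by ring
  set g : ℝ → ℝ := fun x => besselProfile ((M + 1) / 2) (x ^ 2 / 4) with hg
  have hgc : Continuous g := (continuous_besselProfile _).comp (by fun_prop)
  have hg0 : g 0 = 1 := by simp [hg, besselProfile_zero]
  obtain ⟨b, hb, hgb⟩ := exists_besselProfile_nonpos M
  -- The set where the profile is ≤ 0, rather than its zero set: everything to the left of its
  -- minimum is then positive at once.
  have hcomp : IsCompact (Set.Icc 0 b ∩ g ⁻¹' Set.Iic 0) :=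
    isCompact_Icc.inter_right (isClosed_Iic.preimage hgc)
  obtain ⟨B, ⟨⟨hB0, hBb⟩, hgB⟩, hBmin⟩ := hcomp.exists_isLeast ⟨b, ⟨hb.le, le_rfl⟩, hgb⟩
  have hBpos : 0 < B := by
    refine hB0.lt_of_ne fun h => ?_
    rw [← h] at hgB
    simp only [Set.mem_preimage, hg0, Set.mem_Iic] at hgB
    linarith
  have hpos : ∀ x, 0 ≤ x → x < B → 0 < g x := by
    intro x hx hxB
    by_contra! h
    exact absurd (hBmin ⟨⟨hx, hxB.le.trans hBb⟩, h⟩) (not_le.2 hxB)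
  have hgB0 : g B = 0 := by
    refine le_antisymm hgB ?_
    have ht : Tendsto g (𝓝[<] B) (𝓝 (g B)) := hgc.continuousAt.tendsto.mono_left nhdsWithin_le_nhds
    refine ge_of_tendsto ht ?_
    filter_upwards [Ioo_mem_nhdsLT hBpos] with x hx
    exact (hpos x hx.1.le hx.2).le
  refine ⟨B, hBpos, ⟨⟨hBpos, ?_⟩, fun x hx => ?_⟩, hgB0, hpos⟩
  · rw [besselJ_eq_zero_iff hν hBpos, ha]
    exact hgB0
  · by_contra! h
    have := (besselJ_eq_zero_iff hν hx.1).1 hx.2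
    rw [ha] at this
    exact (hpos x hx.1.le h).ne' this

/-! ### The radial Dirichlet problem on a spherical cap -/

/-- The flux P w' starts at 0 and strictly decreases while w is positive. This rules out double
zeros. -/
theorem mul_deriv_neg {γ : ℝ} (hγ : 0 < γ) {P a w w' : ℝ → ℝ}
    (hPw : ∀ x ∈ Set.Ioo 0 γ, HasDerivAt (fun y => P y * w' y) (-(a x * w x)) x)
    (hPwc : ContinuousOn (fun y => P y * w' y) (Set.Icc 0 γ)) (hPw0 : P 0 * w' 0 = 0)
    (ha : ∀ x ∈ Set.Ioo 0 γ, 0 < a x) (hw : ∀ x ∈ Set.Ioo 0 γ, 0 < w x) : P γ * w' γ < 0 := by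
  have h := strictAntiOn_of_deriv_neg (convex_Icc 0 γ) hPwc fun x hx => by
    rw [interior_Icc] at hx
    rw [(hPw x hx).deriv]
    exact neg_lt_zero.2 (mul_pos (ha x hx) (hw x hx))
  have := h ⟨le_rfl, hγ.le⟩ ⟨hγ.le, le_rfl⟩ hγ
  simp only at this
  rwa [hPw0] at this

/-- The solution, in the variable `s = (1 - cos θ) / 2`, of the radial eigenvalue equation on the
sphere of dimension `M + 1` that is regular at the pole. -/
noncomputable def capProfile (M : ℕ) (l : ℝ) : ℝ → ℝ := powerSum (recCoeff ((M + 1) / 2) 1 M l)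

theorem convergesOn_capCoeff (M : ℕ) (l : ℝ) : ConvergesOn (recCoeff ((M + 1) / 2) 1 M l) 1 :=
  convergesOn_recCoeff _ _ _ zero_le_one (one_mul 1).le

theorem capProfile_zero (M : ℕ) (l : ℝ) : capProfile M l 0 = 1 := by
  simp [capProfile, recCoeff]

/-- At l = 0 the factor of the recursion at k = 0 vanishes and the series stops. This constant
solution shows that the critical eigenvalue is not 0. -/
theorem capProfile_eigenvalue_zero (M : ℕ) (s : ℝ) : capProfile M 0 s = 1 := by
  have h : ∀ k : ℕ, recCoeff ((M + 1) / 2) 1 M 0 (k + 1) = 0 := by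
    intro k
    induction k with
    | zero => simp [recCoeff]
    | succ k ih => rw [recCoeff, ih, mul_zero]
  rw [capProfile, powerSum, tsum_eq_single 0 fun k hk => ?_]
  · simp [recCoeff]
  · obtain ⟨k, rfl⟩ := Nat.exists_eq_succ_of_ne_zero hk
    rw [Nat.succ_eq_add_one, h k, zero_mul]

theorem hasDerivAt_capProfile (M : ℕ) (l : ℝ) {s : ℝ} (hs : |s| < 1) :
    HasDerivAt (capProfile M l) (deriv (capProfile M l) s) s :=
  (hasDerivAt_powerSum (convergesOn_capCoeff M l) hs).differentiableAt.hasDerivAt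

theorem deriv_capProfile (M : ℕ) (l : ℝ) {s : ℝ} (hs : |s| < 1) :
    deriv (capProfile M l) s = powerSum (shiftCoeff (recCoeff ((M + 1) / 2) 1 M l)) s :=
  (hasDerivAt_powerSum (convergesOn_capCoeff M l) hs).deriv

theorem hasDerivAt_deriv_capProfile (M : ℕ) (l : ℝ) {s : ℝ} (hs : |s| < 1) :
    HasDerivAt (deriv (capProfile M l))
      (powerSum (shiftCoeff (shiftCoeff (recCoeff ((M + 1) / 2) 1 M l))) s) s := by
  refine (hasDerivAt_powerSum (convergesOn_capCoeff M l).shiftCoeff hs).congr_of_eventuallyEq ?_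
  filter_upwards [(continuous_abs.isOpen_preimage _ isOpen_Iio).mem_nhds hs] with y hy
  exact deriv_capProfile M l hy

theorem capProfile_ode (M : ℕ) (l : ℝ) {s : ℝ} (hs : |s| < 1) :
    s * (1 - s) * deriv (deriv (capProfile M l)) s +
      (M + 1) * (1 / 2 - s) * deriv (capProfile M l) s + l * capProfile M l s = 0 := by
  have h := powerSum_recCoeff_ode (a := ((M : ℝ) + 1) / 2) (ε := 1) (b := M) (l := l)
    (by positivity) zero_le_one (one_mul 1).le hs
  rw [(hasDerivAt_deriv_capProfile M l hs).deriv, deriv_capProfile M l hs, capProfile]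
  linear_combination h

/-- The derivative of `θ ↦ capProfile M l ((1 - cos θ) / 2)`. -/
noncomputable def capDeriv (M : ℕ) (l θ : ℝ) : ℝ :=
  deriv (capProfile M l) ((1 - Real.cos θ) / 2) * (Real.sin θ / 2)

theorem abs_half_one_sub_cos_lt {θ : ℝ} (h0 : 0 ≤ θ) (hπ : θ < Real.pi) :
    |(1 - Real.cos θ) / 2| < 1 := by
  have h1 : -1 < Real.cos θ := by
    rw [← Real.cos_pi]
    exact Real.cos_lt_cos_of_nonneg_of_le_pi h0 le_rfl hπ
  rw [abs_lt]
  constructor <;> linarith [Real.cos_le_one θ]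

theorem hasDerivAt_half_one_sub_cos (θ : ℝ) :
    HasDerivAt (fun θ => (1 - Real.cos θ) / 2) (Real.sin θ / 2) θ := by
  simpa using ((Real.hasDerivAt_cos θ).const_sub 1).div_const 2

theorem hasDerivAt_capRadial (M : ℕ) (l : ℝ) {θ : ℝ} (h0 : 0 ≤ θ) (hπ : θ < Real.pi) :
    HasDerivAt (fun θ => capProfile M l ((1 - Real.cos θ) / 2)) (capDeriv M l θ) θ :=
  (hasDerivAt_capProfile M l (abs_half_one_sub_cos_lt h0 hπ)).comp θ
    (hasDerivAt_half_one_sub_cos θ)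

/-- Since sin² θ = 4 s (1 - s), the hypergeometric equation in s becomes the radial equation in
divergence form with weight sin^M θ. -/
theorem hasDerivAt_sin_pow_mul_capDeriv (M : ℕ) (l : ℝ) {θ : ℝ} (h0 : 0 ≤ θ) (hπ : θ < Real.pi) :
    HasDerivAt (fun θ => Real.sin θ ^ M * capDeriv M l θ)
      (-((l * Real.sin θ ^ M) * capProfile M l ((1 - Real.cos θ) / 2))) θ := by
  have hs := abs_half_one_sub_cos_lt h0 hπ
  have h1 := (hasDerivAt_deriv_capProfile M l hs).comp θ (hasDerivAt_half_one_sub_cos θ)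
  have h2 := (((Real.hasDerivAt_sin θ).pow (M + 1)).mul_const (1 / 2)).mul h1
  have hode := capProfile_ode M l hs
  rw [(hasDerivAt_deriv_capProfile M l hs).deriv] at hode
  convert! h2 using 1
  · ext y
    simp only [capDeriv, Pi.mul_apply, Function.comp_apply, Pi.pow_apply]
    ring
  · simp only [Function.comp_apply, Pi.pow_apply, Nat.add_sub_cancel]
    push_cast
    have hsc := Real.sin_sq_add_cos_sq θ
    set F2 := powerSum (shiftCoeff (shiftCoeff (recCoeff (((M : ℝ) + 1) / 2) 1 M l)))
      ((1 - Real.cos θ) / 2)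
    linear_combination -(Real.sin θ ^ M) * hode - Real.sin θ ^ M * F2 / 4 * hsc

theorem continuousOn_sin_pow_mul_capDeriv (M : ℕ) (l : ℝ) {γ : ℝ} (hπ : γ < Real.pi) :
    ContinuousOn (fun θ => Real.sin θ ^ M * capDeriv M l θ) (Set.Icc 0 γ) := fun _ hθ =>
  (hasDerivAt_sin_pow_mul_capDeriv M l hθ.1
    (hθ.2.trans_lt hπ)).continuousAt.continuousWithinAt

theorem capDeriv_zero (M : ℕ) (l : ℝ) : capDeriv M l 0 = 0 := by simp [capDeriv]

/-- The chord of the concave sine from 0 to γ lies below its graph. -/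
theorem mul_le_sin_of_le {γ x : ℝ} (hγ : 0 < γ) (hπ : γ < Real.pi) (hx : 0 ≤ x) (hxγ : x ≤ γ) :
    Real.sin γ / γ * x ≤ Real.sin x := by
  have h0 : (0 : ℝ) ∈ Set.Icc 0 Real.pi := ⟨le_rfl, Real.pi_pos.le⟩
  have h1 : γ ∈ Set.Icc 0 Real.pi := ⟨hγ.le, hπ.le⟩
  have h2 : 0 ≤ 1 - x / γ := sub_nonneg.2 ((div_le_one hγ).2 hxγ)
  have h3 : 0 ≤ x / γ := by positivity
  have h := strictConcaveOn_sin_Icc.concaveOn.2 h0 h1 h2 h3 (by ring)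
  simp only [smul_eq_mul, mul_zero, Real.sin_zero, zero_add] at h
  rw [div_mul_cancel₀ _ hγ.ne'] at h
  calc _ = x / γ * Real.sin γ := by ring
    _ ≤ _ := h

/-- The eigenvalue is the least l for which the regular solution touches or crosses 0 on [0, γ]; the
two bounds are Sturm–Picone comparisons with the flat solution, taken in opposite directions. -/
theorem exists_capProfile_first_zero (M : ℕ) {γ B : ℝ} (hγ : 0 < γ) (hγπ : γ < Real.pi)
    (hB : 0 < B) (hB0 : besselProfile ((M + 1) / 2) (B ^ 2 / 4) = 0)
    (hBpos : ∀ x, 0 ≤ x → x < B → 0 < besselProfile ((M + 1) / 2) (x ^ 2 / 4)) :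
    ∃ l : ℝ, (∀ θ, 0 ≤ θ → θ < γ → 0 < capProfile M l ((1 - Real.cos θ) / 2)) ∧
      capProfile M l ((1 - Real.cos γ) / 2) = 0 ∧
      (Real.sin γ / γ) ^ M * (B / γ) ^ 2 ≤ l ∧ l ≤ (γ / Real.sin γ) ^ M * (B / γ) ^ 2 := by
  have hsγ : 0 < Real.sin γ := Real.sin_pos_of_pos_of_lt_pi hγ hγπ
  set c : ℝ := (Real.sin γ / γ) ^ M with hc
  have hcpos : 0 < c := by positivity
  have hcinv : (γ / Real.sin γ) ^ M = c⁻¹ := by rw [hc, ← inv_pow, inv_div]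
  set μ : ℝ := (B / γ) ^ 2 with hμ
  have hμpos : 0 < μ := by positivity
  have hsin : ∀ x ∈ Set.Ioo 0 γ, 0 < Real.sin x := fun x hx =>
    Real.sin_pos_of_pos_of_lt_pi hx.1 (hx.2.trans hγπ)
  have hsin_le : ∀ x ∈ Set.Ioo 0 γ, Real.sin x ^ M ≤ x ^ M := fun x hx =>
    pow_le_pow_left₀ (hsin x hx).le (Real.sin_le hx.1.le) M
  have hle_sin : ∀ x ∈ Set.Ioo 0 γ, c * x ^ M ≤ Real.sin x ^ M := fun x hx => by
    rw [hc, ← mul_pow]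
    exact pow_le_pow_left₀ (by have := hx.1; positivity) (mul_le_sin_of_le hγ hγπ hx.1.le hx.2.le) M
  have hflat : ∀ r : ℝ, μ * r ^ 2 / 4 = (B / γ * r) ^ 2 / 4 := fun r => by rw [hμ]; ring
  have hflatpos : ∀ x ∈ Set.Ico 0 γ, 0 < besselProfile ((M + 1) / 2) (μ * x ^ 2 / 4) := by
    intro x hx
    rw [hflat]
    refine hBpos _ (by have := hx.1; positivity) ?_
    rw [div_mul_eq_mul_div, div_lt_iff₀ hγ]
    exact mul_lt_mul_of_pos_left hx.2 hB
  have hflatγ : besselProfile ((M + 1) / 2) (μ * γ ^ 2 / 4) = 0 := by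
    rw [hflat, div_mul_cancel₀ _ hγ.ne', hB0]
  set W : ℝ → ℝ → ℝ := fun l θ => capProfile M l ((1 - Real.cos θ) / 2) with hW
  -- Here the cap solution plays the positive role and the flat one vanishes at γ; l c > μ makes l
  -- sin^M exceed μ x^M.
  have hupper : ∀ l, μ / c < l → ∃ θ ∈ Set.Icc 0 γ, W l θ ≤ 0 := by
    intro l hl
    by_contra! hpos
    rw [div_lt_iff₀ hcpos] at hl
    have hl0 : 0 < l := pos_of_mul_pos_left (hμpos.trans hl) hcpos.le
    refine sturm_picone hγ (P := fun x => Real.sin x ^ M) (Q := fun x => x ^ M)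
      (a := fun x => l * Real.sin x ^ M) (b := fun x => μ * x ^ M)
      (fun x hx => pow_pos (hsin x hx) M) hsin_le
      (fun x hx => hasDerivAt_capRadial M l hx.1 (hx.2.trans_lt hγπ))
      (fun x _ => hasDerivAt_flat ((M + 1) / 2) μ x)
      (fun x hx => hasDerivAt_sin_pow_mul_capDeriv M l hx.1.le (hx.2.trans hγπ))
      (fun x _ => hasDerivAt_pow_mul_flatDeriv M μ x) (fun x hx => ?_)
      (continuousOn_sin_pow_mul_capDeriv M l hγπ) (continuous_pow_mul_flatDeriv M μ).continuousOn
      (by rw [capDeriv_zero, mul_zero]) (by simp [flatDeriv])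
      (fun x hx => hpos x ⟨hx.1, hx.2.le⟩) (.inl (hpos γ ⟨hγ.le, le_rfl⟩)) hflatγ
    refine mul_lt_mul_of_pos_right ?_ (pow_pos (hflatpos x ⟨hx.1.le, hx.2⟩) 2)
    calc μ * x ^ M < l * c * x ^ M := mul_lt_mul_of_pos_right hl (pow_pos hx.1 M)
      _ = l * (c * x ^ M) := by ring
      _ ≤ l * Real.sin x ^ M := by have := hle_sin x hx; gcongr
  -- Any bound beyond μ/c serves: it makes the compact set of pairs (l, θ) with W ≤ 0 nonempty.
  set L : ℝ := μ / c + 1 with hL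
  have hLpos : 0 < L := by positivity
  have hcont : ContinuousOn (fun p : ℝ × ℝ => W p.1 p.2) (Set.Icc 0 L ×ˢ Set.Icc 0 γ) := by
    have hσ := (abs_lt.1 (abs_half_one_sub_cos_lt hγ.le hγπ)).2
    have hσ0 : 0 < (1 - Real.cos γ) / 2 := by
      have : Real.cos γ < Real.cos 0 := Real.cos_lt_cos_of_nonneg_of_le_pi le_rfl hγπ.le hγ
      rw [Real.cos_zero] at this
      linarith
    have hF := continuousOn_powerSum_recCoeff (a := ((M : ℝ) + 1) / 2) (b := M) (L := L)
      (by positivity) (by positivity) hσ0 hσ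
    refine hF.comp (f := fun p : ℝ × ℝ => (p.1, (1 - Real.cos p.2) / 2))
      (Continuous.continuousOn (by fun_prop)) fun p hp => ⟨hp.1, ?_, ?_⟩
    · linarith [Real.cos_le_one p.2]
    · have := Real.cos_le_cos_of_nonneg_of_le_pi hp.2.1 hγπ.le hp.2.2
      simp only
      linarith
  have hcomp : IsCompact ((Set.Icc 0 L ×ˢ Set.Icc 0 γ) ∩
      (fun p : ℝ × ℝ => W p.1 p.2) ⁻¹' Set.Iic 0) :=
    (isCompact_Icc.prod isCompact_Icc).of_isClosed_subset
      (hcont.preimage_isClosed_of_isClosed (isClosed_Icc.prod isClosed_Icc) isClosed_Iic)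
      Set.inter_subset_left
  obtain ⟨l, ⟨⟨l', θ₁⟩, ⟨⟨hl, hθ₁⟩, hWθ₁⟩, rfl⟩, hmin⟩ :=
      (hcomp.image continuous_fst).exists_isLeast (by
    obtain ⟨θ, hθ, hWθ⟩ := hupper L (by rw [hL]; linarith)
    exact ⟨L, (L, θ), ⟨⟨⟨hLpos.le, le_rfl⟩, hθ⟩, hWθ⟩, rfl⟩)
  simp only at hl hθ₁ hWθ₁ hmin
  have hl0 : 0 < l' := by
    refine hl.1.lt_of_ne fun h => ?_
    rw [← h] at hWθ₁
    simp only [hW, Set.mem_preimage, capProfile_eigenvalue_zero, Set.mem_Iic] at hWθ₁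
    linarith
  -- For k < l' the solution is positive by minimality; let k increase to l'.
  have hnonneg : ∀ θ ∈ Set.Icc 0 γ, 0 ≤ W l' θ := by
    intro θ hθ
    have hc1 : ContinuousOn (fun k => W k θ) (Set.Icc 0 L) :=
      hcont.comp (f := fun k : ℝ => (k, θ)) (Continuous.continuousOn (by fun_prop))
        fun k hk => ⟨hk, hθ⟩
    have ht : Tendsto (fun k => W k θ) (𝓝[Set.Ioo 0 l'] l') (𝓝 (W l' θ)) :=
      ((hc1 l' hl).mono fun k hk => ⟨hk.1.le, hk.2.le.trans hl.2⟩).tendsto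
    have : (𝓝[Set.Ioo 0 l'] l').NeBot := right_nhdsWithin_Ioo_neBot hl0
    refine ge_of_tendsto ht ?_
    filter_upwards [self_mem_nhdsWithin] with k hk
    by_contra! h
    exact absurd (hmin ⟨(k, θ), ⟨⟨⟨hk.1.le, hk.2.le.trans hl.2⟩, hθ⟩, h.le⟩, rfl⟩) (not_le.2 hk.2)
  have hcW : ContinuousOn (W l') (Set.Icc 0 γ) := fun _ hθ =>
    (hasDerivAt_capRadial M l' hθ.1 (hθ.2.trans_lt hγπ)).continuousAt.continuousWithinAt
  obtain ⟨θ₀, ⟨hθ₀, hWθ₀⟩, hθ₀min⟩ := (isCompact_Icc.of_isClosed_subset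
    (hcW.preimage_isClosed_of_isClosed isClosed_Icc isClosed_Iic)
      Set.inter_subset_left).exists_isLeast ⟨θ₁, hθ₁, hWθ₁⟩
  have hpos₀ : ∀ θ, 0 ≤ θ → θ < θ₀ → 0 < W l' θ := by
    intro θ h0 h1
    by_contra! h
    exact absurd (hθ₀min ⟨⟨h0, h1.le.trans hθ₀.2⟩, h⟩) (not_le.2 h1)
  have hWθ₀' : W l' θ₀ = 0 := le_antisymm hWθ₀ (hnonneg θ₀ hθ₀)
  have hθ₀pos : 0 < θ₀ := by
    refine hθ₀.1.lt_of_ne fun h => ?_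
    rw [← h] at hWθ₀'
    simp [hW, capProfile_zero] at hWθ₀'
  -- A zero before γ would be an interior minimum, where the derivative vanishes, contradicting the
  -- negative flux.
  have hθ₀γ : θ₀ = γ := by
    refine hθ₀.2.eq_of_not_lt fun hlt => ?_
    have hmin' : IsLocalMin (W l') θ₀ := by
      filter_upwards [Ioo_mem_nhds hθ₀pos hlt] with θ hθ
      rw [hWθ₀']
      exact hnonneg θ ⟨hθ.1.le, hθ.2.le⟩
    have hd := hmin'.hasDerivAt_eq_zero (hasDerivAt_capRadial M l' hθ₀.1 (hlt.trans hγπ))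
    have hneg := mul_deriv_neg hθ₀pos (P := fun x => Real.sin x ^ M)
      (a := fun x => l' * Real.sin x ^ M) (w := W l') (w' := capDeriv M l')
      (fun x hx => hasDerivAt_sin_pow_mul_capDeriv M l' hx.1.le (hx.2.trans (hlt.trans hγπ)))
      (continuousOn_sin_pow_mul_capDeriv M l' (hlt.trans hγπ)) (by rw [capDeriv_zero, mul_zero])
      (fun x hx => mul_pos hl0 (pow_pos (hsin x ⟨hx.1, hx.2.trans hlt⟩) M))
      (fun x hx => hpos₀ x hx.1.le hx.2)
    rw [hd, mul_zero] at hneg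
    exact lt_irrefl _ hneg
  subst hθ₀γ
  refine ⟨l', hpos₀, hWθ₀', ?_, ?_⟩
  -- The roles are exchanged. The flat equation is multiplied by c so that its weight c x^M lies
  -- below sin^M x; its solution vanishes at γ, but only simply, by `hneg`.
  · by_contra! hlt
    have hneg := mul_deriv_neg hγ (P := fun x => x ^ M) (a := fun x => μ * x ^ M)
      (w := fun r => besselProfile ((M + 1) / 2) (μ * r ^ 2 / 4))
      (w' := flatDeriv ((M + 1) / 2) μ)
      (fun x _ => hasDerivAt_pow_mul_flatDeriv M μ x)
      (continuous_pow_mul_flatDeriv M μ).continuousOn (by simp [flatDeriv])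
      (fun x hx => mul_pos hμpos (pow_pos hx.1 M)) (fun x hx => hflatpos x ⟨hx.1.le, hx.2⟩)
    refine sturm_picone hγ (P := fun x => c * x ^ M) (Q := fun x => Real.sin x ^ M)
      (a := fun x => c * (μ * x ^ M)) (b := fun x => l' * Real.sin x ^ M)
      (fun x hx => mul_pos hcpos (pow_pos hx.1 M)) hle_sin
      (fun x _ => hasDerivAt_flat ((M + 1) / 2) μ x)
      (fun x hx => hasDerivAt_capRadial M l' hx.1 (hx.2.trans_lt hγπ))
      (fun x _ => ?_)
      (fun x hx => hasDerivAt_sin_pow_mul_capDeriv M l' hx.1.le (hx.2.trans hγπ)) (fun x hx => ?_)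
      ?_ (continuousOn_sin_pow_mul_capDeriv M l' hγπ)
      (by simp [flatDeriv]) (by rw [capDeriv_zero, mul_zero])
      hflatpos (.inr ⟨hflatγ, fun h => ?_⟩) hWθ₀'
    · convert! (hasDerivAt_pow_mul_flatDeriv M μ x).const_mul c using 1
      · ext y; ring
      · ring
    · refine mul_lt_mul_of_pos_right ?_ (pow_pos (hpos₀ x hx.1.le hx.2) 2)
      have := pow_pos hx.1 M
      calc l' * Real.sin x ^ M ≤ l' * x ^ M := by have := hsin_le x hx; gcongr
        _ < c * μ * x ^ M := mul_lt_mul_of_pos_right hlt this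
        _ = _ := by ring
    · refine ((continuous_pow_mul_flatDeriv M μ).const_mul c).continuousOn.congr fun y _ => ?_
      ring
    · simp only [h, mul_zero, lt_irrefl] at hneg
  · rw [hcinv, inv_mul_eq_div]
    refine le_of_forall_gt_imp_ge_of_dense fun k hk => ?_
    rcases le_or_gt k L with hkL | hkL
    · obtain ⟨θ, hθ, hWθ⟩ := hupper k hk
      exact hmin ⟨(k, θ), ⟨⟨⟨(div_pos hμpos hcpos).le.trans hk.le, hkL⟩, hθ⟩, hWθ⟩, rfl⟩
    · exact hl.2.trans hkL.le

/-! ### Integration by parts on the sphere -/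

/-- The cutoff vanishes near the origin, the only place where a function homogeneous of degree 0 may
be singular. -/
theorem continuous_norm_mul {E : Type*} [NormedAddCommGroup E] {k : ℝ → ℝ}
    (hk : Continuous k) (hk0 : ∀ r, r ≤ 1 → k r = 0) {H : E → ℝ}
    (hH : ∀ x, x ≠ 0 → ContinuousAt H x) :
    Continuous fun x => k ‖x‖ * H x := by
  refine continuous_iff_continuousAt.2 fun x => ?_
  by_cases hx : x = 0
  · have : (fun x => k ‖x‖ * H x) =ᶠ[𝓝 x] fun _ => 0 := by
      have hlt : ‖x‖ < 1 := by simp [hx]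
      filter_upwards [continuous_norm.continuousAt.eventually_lt_const hlt] with y hy
      rw [hk0 _ hy.le, zero_mul]
    exact continuousAt_const.congr this.symm
  · exact (hk.continuousAt.comp continuous_norm.continuousAt).mul (hH x hx)

section Polar

variable {E : Type*} [NormedAddCommGroup E] [InnerProductSpace ℝ E]

theorem hasFDerivAt_norm {x : E} (hx : x ≠ 0) :
    HasFDerivAt (fun y : E => ‖y‖) (‖x‖⁻¹ • innerSL ℝ x) x := by
  have h := (hasStrictFDerivAt_norm_sq x).hasFDerivAt.sqrt (pow_ne_zero 2 (norm_ne_zero_iff.2 hx))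
  simp only [Real.sqrt_sq (norm_nonneg _)] at h
  convert! h using 1
  ext v
  simp
  field_simp

/-- The radial projection of `E \ {0}` onto the unit sphere. -/
noncomputable def radialProj (x : E) : E := ‖x‖⁻¹ • x

theorem norm_radialProj {x : E} (hx : x ≠ 0) : ‖radialProj x‖ = 1 := by
  simp [radialProj, norm_smul, hx]

theorem radialProj_of_norm_eq_one {x : E} (hx : ‖x‖ = 1) : radialProj x = x := by
  simp [radialProj, hx]

theorem radialProj_smul {r : ℝ} (hr : 0 < r) (x : E) : radialProj (r • x) = radialProj x := by
  rw [radialProj, radialProj, norm_smul, Real.norm_eq_abs, abs_of_pos hr, smul_smul, mul_inv,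
    mul_right_comm, inv_mul_cancel₀ hr.ne', one_mul]

theorem contDiffAt_radialProj {x : E} (hx : x ≠ 0) {n : WithTop ℕ∞} :
    ContDiffAt ℝ n (radialProj : E → E) x :=
  ((contDiffAt_norm ℝ hx).inv (norm_ne_zero_iff.2 hx)).smul contDiffAt_id

theorem hasFDerivAt_radialProj {x : E} (hx : ‖x‖ = 1) :
    HasFDerivAt (radialProj : E → E)
      (ContinuousLinearMap.id ℝ E - (innerSL ℝ x).smulRight x) x := by
  have hx0 : x ≠ 0 := norm_ne_zero_iff.1 (by simp [hx])
  have h1 := (hasDerivAt_inv (norm_ne_zero_iff.2 hx0)).comp_hasFDerivAt x (hasFDerivAt_norm hx0)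
  have h2 := h1.smul (hasFDerivAt_id x)
  convert! h2 using 1
  ext v
  simp [hx, sub_eq_add_neg]

theorem fderiv_smul_of_homogeneous {η : E → ℝ} (hη : ∀ r : ℝ, 0 < r → ∀ x, η (r • x) = η x)
    {r : ℝ} (hr : 0 < r) (x v : E) : r * fderiv ℝ η (r • x) v = fderiv ℝ η x v := by
  have h : fderiv ℝ (fun y => η (r • y)) x = r • fderiv ℝ η (r • x) := by
    rw [fderiv_comp_smul]
  have h2 : (fun y => η (r • y)) = η := funext fun y => hη r hr y
  rw [h2] at h
  rw [h]
  simp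

variable [FiniteDimensional ℝ E] [MeasurableSpace E] [BorelSpace E]

theorem integrable_norm_mul (μ : Measure E) [IsFiniteMeasureOnCompacts μ] {k : ℝ → ℝ}
    (hk : Continuous k) (hk0 : ∀ r, r ≤ 1 → k r = 0) (hk3 : ∀ r, 3 ≤ r → k r = 0)
    {H : E → ℝ} (hH : ∀ x, x ≠ 0 → ContinuousAt H x) : Integrable (fun x => k ‖x‖ * H x) μ := by
  refine (continuous_norm_mul hk hk0 hH).integrable_of_hasCompactSupport ?_
  refine HasCompactSupport.of_support_subset_isCompact (isCompact_closedBall (0 : E) 3) ?_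
  intro x hx
  rw [mem_closedBall_zero_iff]
  by_contra! h
  exact hx (by simp [hk3 _ h.le])

/-- Polar coordinates: a radial factor times a function of direction alone integrates to a product.
-/
theorem integral_norm_mul [Nontrivial E] (μ : Measure E) [μ.IsAddHaarMeasure] (k : ℝ → ℝ)
    {H : E → ℝ} (hH : ∀ r : ℝ, 0 < r → ∀ x, H (r • x) = H x) :
    ∫ x, k ‖x‖ * H x ∂μ = (∫ x : Metric.sphere (0 : E) 1, H x ∂μ.toSphere) *
      ∫ r in Set.Ioi (0 : ℝ), r ^ (Module.finrank ℝ E - 1) * k r := by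
  calc ∫ x, k ‖x‖ * H x ∂μ = ∫ x : ({(0)}ᶜ : Set E), k ‖x.1‖ * H x ∂(μ.comap (↑)) := by
        rw [integral_subtype_comap (measurableSet_singleton _).compl fun x => k ‖x‖ * H x,
          restrict_compl_singleton]
    _ = ∫ z, H z.1 * k z.2 ∂μ.toSphere.prod (.volumeIoiPow (Module.finrank ℝ E - 1)) := by
        rw [← μ.measurePreserving_homeomorphUnitSphereProd.integral_comp
          (Homeomorph.measurableEmbedding _)
          (fun z : Metric.sphere (0 : E) 1 × Set.Ioi (0 : ℝ) => H z.1 * k z.2)]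
        refine integral_congr_ae (ae_of_all _ fun x => ?_)
        have hx : 0 < ‖x.1‖ := norm_pos_iff.2 x.2
        simp only [homeomorphUnitSphereProd_apply_snd_coe, homeomorphUnitSphereProd_apply_fst_coe]
        rw [hH _ (inv_pos.2 hx), mul_comm]
    _ = (∫ x : Metric.sphere (0 : E) 1, H x ∂μ.toSphere) *
          ∫ r : Set.Ioi (0 : ℝ), k r ∂.volumeIoiPow (Module.finrank ℝ E - 1) :=
        integral_prod_mul (fun x : Metric.sphere (0 : E) 1 => H x) fun r : Set.Ioi (0 : ℝ) => k r
    _ = _ := by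
        congr 1
        simp only [Measure.volumeIoiPow, ENNReal.ofReal]
        rw [integral_withDensity_eq_integral_smul,
          integral_subtype_comap measurableSet_Ioi
            fun a => Real.toNNReal (a ^ (Module.finrank ℝ E - 1)) • k a,
          setIntegral_congr_fun measurableSet_Ioi fun x hx => ?_]
        · rw [NNReal.smul_def, Real.coe_toNNReal _ (pow_nonneg hx.out.le _), smul_eq_mul]
        · exact (measurable_subtype_coe.pow_const _).real_toNNReal

/-- The divergence theorem on the unit sphere for the tangential part of the constant field `e`. -/
theorem integral_sphere_fderiv {d : ℕ} (hd : Module.finrank ℝ E = d + 2) (μ : Measure E)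
    [μ.IsAddHaarMeasure] {η : E → ℝ} (hη : ∀ r : ℝ, 0 < r → ∀ x, η (r • x) = η x)
    (hη1 : ∀ x, x ≠ 0 → ContDiffAt ℝ 1 η x) (e : E) :
    ∫ x : Metric.sphere (0 : E) 1, fderiv ℝ η x e ∂μ.toSphere =
      (d + 1) * ∫ x : Metric.sphere (0 : E) 1, inner ℝ (x : E) e * η x ∂μ.toSphere := by
  have : Nontrivial E := Module.nontrivial_of_finrank_pos (R := ℝ) (by omega)
  -- A radial cutoff supported in the shell 1 ≤ r ≤ 3, away from the origin.
  let b : ContDiffBump (2 : ℝ) := ⟨1 / 2, 1, by norm_num, by norm_num⟩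
  set χ : ℝ → ℝ := fun r => b r with hχ
  have hχs : ContDiff ℝ ∞ χ := b.contDiff
  have hχ0 : ∀ r, r ≤ 1 → χ r = 0 := fun r hr => b.zero_of_le_dist (by
    show (1 : ℝ) ≤ dist r 2
    rw [Real.dist_eq, abs_of_nonpos] <;> linarith)
  have hχ3 : ∀ r, 3 ≤ r → χ r = 0 := fun r hr => b.zero_of_le_dist (by
    show (1 : ℝ) ≤ dist r 2
    rw [Real.dist_eq, abs_of_nonneg] <;> linarith)
  have hsupp : ∀ r, r ∉ Set.Icc (1 : ℝ) 3 → χ r = 0 := fun r hr => by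
    by_cases h : 1 ≤ r
    · exact hχ3 r (not_lt.1 fun h3 => hr ⟨h, h3.le⟩)
    · exact hχ0 r (not_le.1 h).le
  have hts : tsupport χ ⊆ Set.Icc 1 3 := by
    refine closure_minimal (fun r hr => ?_) isClosed_Icc
    by_contra h
    exact hr (hsupp r h)
  have hχc : HasCompactSupport χ := isCompact_Icc.of_isClosed_subset (isClosed_tsupport χ) hts
  have hχd : Continuous (deriv χ) := hχs.continuous_deriv (by simp)
  have hd_eq : ∀ r, r ∉ Set.Ioo (1 : ℝ) 3 → deriv χ r = 0 := by
    intro r hr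
    have hχr : χ r = 0 := by
      by_cases h : 1 < r
      · exact hχ3 r (not_lt.1 fun h3 => hr ⟨h, h3⟩)
      · exact hχ0 r (not_lt.1 h)
    have hmin : IsLocalMin χ r := Eventually.of_forall fun y => by rw [hχr]; exact b.nonneg
    exact hmin.deriv_eq_zero
  have hd0 : ∀ r, r ≤ 1 → deriv χ r = 0 := fun r hr => hd_eq r fun h => absurd h.1 (not_lt.2 hr)
  have hd3 : ∀ r, 3 ≤ r → deriv χ r = 0 := fun r hr => hd_eq r fun h => absurd h.2 (not_lt.2 hr)
  have hηc : ∀ x, x ≠ 0 → ContinuousAt η x := fun x hx => (hη1 x hx).continuousAt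
  have hη'c : ∀ x, x ≠ 0 → ContinuousAt (fun x => fderiv ℝ η x e) x := fun x hx =>
    (((hη1 x hx).fderiv_right (m := 0) (by simp)).continuousAt).clm_apply continuousAt_const
  have htc : ∀ x : E, x ≠ 0 → ContinuousAt (fun x => ‖x‖⁻¹ * inner ℝ x e * η x) x := fun x hx =>
    ((continuous_norm.continuousAt.inv₀ (norm_ne_zero_iff.2 hx)).mul
      (Continuous.continuousAt (by fun_prop))).mul (hηc x hx)
  have hfd : ∀ x : E, HasFDerivAt (fun y => χ ‖y‖) (deriv χ ‖x‖ • ‖x‖⁻¹ • innerSL ℝ x) x := by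
    intro x
    by_cases hx : x = 0
    · have h0 : (fun y : E => χ ‖y‖) =ᶠ[𝓝 x] fun _ => 0 := by
        have hlt : ‖x‖ < 1 := by simp [hx]
        filter_upwards [continuous_norm.continuousAt.eventually_lt_const hlt] with y hy
        exact hχ0 _ hy.le
      have := (hasFDerivAt_const (𝕜 := ℝ) (0 : ℝ) x).congr_of_eventuallyEq h0
      simpa [hx] using this
    · have h1 : HasDerivAt χ (deriv χ ‖x‖) ‖x‖ := ((hχs.differentiable (by simp)) _).hasDerivAt
      exact h1.comp_hasFDerivAt x (hasFDerivAt_norm hx)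
  have hfde : ∀ x : E, fderiv ℝ (fun y : E => χ ‖y‖) x e * η x =
      deriv χ ‖x‖ * (‖x‖⁻¹ * inner ℝ x e * η x) := fun x => by
    rw [(hfd x).fderiv]
    simp
    ring
  have hibp : ∫ x : E, χ ‖x‖ * fderiv ℝ η x e ∂μ =
      -∫ x : E, fderiv ℝ (fun y : E => χ ‖y‖) x e * η x ∂μ := by
    refine integral_mul_fderiv_eq_neg_fderiv_mul_of_integrable ?_
      (integrable_norm_mul μ hχs.continuous hχ0 hχ3 hη'c)
      (integrable_norm_mul μ hχs.continuous hχ0 hχ3 hηc)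
      (fun x _ => (hfd x).differentiableAt) fun x hx => ?_
    · simp only [hfde]
      exact integrable_norm_mul μ hχd hd0 hd3 htc
    · refine (hη1 x fun h => ?_).differentiableAt (by simp)
      have hmem : tsupport (fun y : E => χ ‖y‖) ⊆ {y | 1 ≤ ‖y‖} := by
        refine closure_minimal (fun y hy => ?_) (isClosed_le continuous_const continuous_norm)
        by_contra hlt
        exact hy (hχ0 _ (not_le.1 hlt).le)
      have := hmem hx
      simp only [h, Set.mem_ofPred_eq, norm_zero] at this
      linarith
  simp only [hfde] at hibp
  have hL : ∫ x : E, χ ‖x‖ * fderiv ℝ η x e ∂μ =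
      ∫ x : E, (χ ‖x‖ / ‖x‖) * (‖x‖ * fderiv ℝ η x e) ∂μ := by
    refine integral_congr_ae (ae_of_all _ fun x => ?_)
    by_cases hx : x = 0
    · simp [hx, hχ0]
    · have := norm_ne_zero_iff.2 hx
      simp only
      field_simp
  rw [hL, integral_norm_mul μ (fun r => χ r / r) (H := fun x => ‖x‖ * fderiv ℝ η x e) (by
      intro r hr x
      simp only [norm_smul, Real.norm_eq_abs, abs_of_pos hr]
      rw [← fderiv_smul_of_homogeneous hη hr x e]
      ring), integral_norm_mul μ (deriv χ) (H := fun x => ‖x‖⁻¹ * inner ℝ x e * η x) (by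
      intro r hr x
      simp only [norm_smul, Real.norm_eq_abs, abs_of_pos hr, hη r hr, real_inner_smul_left, mul_inv]
      rw [mul_mul_mul_comm, inv_mul_cancel₀ hr.ne', one_mul])] at hibp
  have hdim : Module.finrank ℝ E - 1 = d + 1 := by omega
  rw [hdim] at hibp
  have hI : ∫ r in Set.Ioi (0 : ℝ), r ^ (d + 1) * (χ r / r) = ∫ r : ℝ, r ^ d * χ r := by
    rw [← setIntegral_eq_integral_of_forall_compl_eq_zero (s := Set.Ioi (0 : ℝ))
      (f := fun r : ℝ => r ^ d * χ r) fun r hr => ?_]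
    · refine setIntegral_congr_fun measurableSet_Ioi fun r hr => ?_
      have : r ≠ 0 := ne_of_gt hr
      field_simp
      ring
    · rw [hχ0 r ((not_lt.1 (Set.mem_Ioi.not.1 hr)).trans zero_le_one), mul_zero]
  have hJ : ∫ r in Set.Ioi (0 : ℝ), r ^ (d + 1) * deriv χ r = ∫ r : ℝ, r ^ (d + 1) * deriv χ r := by
    refine setIntegral_eq_integral_of_forall_compl_eq_zero fun r hr => ?_
    rw [hd0 r ((not_lt.1 (Set.mem_Ioi.not.1 hr)).trans zero_le_one), mul_zero]
  -- The factor d + 1 of the conclusion is born here; the remaining radial integral is positive and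
  -- cancels at the end.
  have hIJ : ∫ r : ℝ, r ^ (d + 1) * deriv χ r = -∫ r : ℝ, ((d + 1) * r ^ d) * χ r := by
    refine integral_mul_deriv_eq_deriv_mul_of_integrable (fun r _ => ?_)
      (fun r _ => ((hχs.differentiable (by simp)) r).hasDerivAt) ?_ ?_ ?_
    · simpa using hasDerivAt_pow (d + 1) r
    · exact Continuous.integrable_of_hasCompactSupport (by fun_prop) hχc.deriv.mul_left
    · exact Continuous.integrable_of_hasCompactSupport
        ((by fun_prop : Continuous fun r : ℝ => ((d : ℝ) + 1) * r ^ d).mul hχs.continuous)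
        hχc.mul_left
    · exact Continuous.integrable_of_hasCompactSupport
        ((by fun_prop : Continuous fun r : ℝ => r ^ (d + 1)).mul hχs.continuous) hχc.mul_left
  have hIpos : 0 < ∫ r : ℝ, r ^ d * χ r := by
    refine Continuous.integral_pos_of_hasCompactSupport_nonneg_nonzero (x := 2)
      ((by fun_prop : Continuous fun r : ℝ => r ^ d).mul hχs.continuous) hχc.mul_left
      (fun r => ?_) ?_
    · by_cases h : r ≤ 1
      · simp [hχ0 r h]
      · have : 0 ≤ χ r := b.nonneg
        have : 0 < r := by linarith
        simp only [Pi.zero_apply]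
        positivity
    · have : χ 2 = 1 := b.one_of_mem_closedBall (by simp [b.rIn_pos.le])
      rw [this]
      positivity
  rw [hI, hJ, hIJ] at hibp
  simp only [mul_assoc, integral_const_mul] at hibp
  have hsph : ∀ x : Metric.sphere (0 : E) 1, ‖(x : E)‖ = 1 := fun x => by simp
  simp only [hsph, one_mul, inv_one] at hibp
  refine mul_right_cancel₀ hIpos.ne' ?_
  linear_combination hibp

end Polar

/-! ### Tangential gradients and the polar coordinate -/

/-- The height-type coordinate `(1 - ⟨e, x⟩) / 2`, which is `(1 - cos θ) / 2` on the sphere. -/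
noncomputable def polarCoord {N : ℕ} (e x : Space N) : ℝ := (1 - inner ℝ e x) / 2

theorem contDiff_polarCoord {N : ℕ} (e : Space N) {n : WithTop ℕ∞} :
    ContDiff ℝ n (polarCoord e) :=
  (contDiff_const.sub (contDiff_const.inner ℝ contDiff_id)).div_const 2

/-- The extension of degree 0 has no radial derivative, so its Euclidean derivative on the sphere is
the tangential gradient of φ. -/
theorem fderiv_comp_radialProj {N : ℕ} {φ : Space N → ℝ} (x : Sphere N)
    (hφ : DifferentiableAt ℝ φ x) (v : Space N) :
    fderiv ℝ (fun y => φ (radialProj y)) x v = inner ℝ v (sphereGrad φ x) := by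
  have hx : ‖(x : Space N)‖ = 1 := by simp
  have hφ' : HasFDerivAt φ (fderiv ℝ φ x) (radialProj (x : Space N)) := by
    rw [radialProj_of_norm_eq_one hx]; exact hφ.hasFDerivAt
  have h := (hφ'.comp (x : Space N) (hasFDerivAt_radialProj hx)).fderiv
  have hg : ∀ w, fderiv ℝ φ x w = inner ℝ (gradient φ (x : Space N)) w := fun w => by
    simp [gradient]
  rw [show (fun y => φ (radialProj y)) = φ ∘ radialProj from rfl, h]
  simp only [ContinuousLinearMap.comp_apply, hg, sphereGrad]
  simp only [sub_apply, ContinuousLinearMap.id_apply,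
    ContinuousLinearMap.smulRight_apply, innerSL_apply_apply, inner_sub_right, inner_smul_right]
  rw [real_inner_comm v, real_inner_comm (x : Space N) (gradient φ x),
    real_inner_comm v (x : Space N)]
  ring

theorem inner_self_sphereGrad {N : ℕ} (φ : Space N → ℝ) (x : Sphere N) :
    inner ℝ (x : Space N) (sphereGrad φ x) = 0 := by
  simp [sphereGrad, inner_sub_right, inner_smul_right]

theorem sphereGrad_comp {N : ℕ} {Φ : ℝ → ℝ} {φ : Space N → ℝ} (x : Sphere N)
    (hΦ : DifferentiableAt ℝ Φ (φ x)) (hφ : DifferentiableAt ℝ φ x) :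
    sphereGrad (fun y => Φ (φ y)) x = deriv Φ (φ x) • sphereGrad φ x := by
  have h : gradient (fun y => Φ (φ y)) (x : Space N) =
      deriv Φ (φ x) • gradient φ (x : Space N) := by
    refine HasGradientAt.gradient ?_
    rw [hasGradientAt_iff_hasFDerivAt]
    convert! hΦ.hasDerivAt.comp_hasFDerivAt (x : Space N) hφ.hasFDerivAt using 1
    simp [gradient]
  simp only [sphereGrad, h, inner_smul_right, smul_sub, smul_smul]

theorem sphereGrad_polarCoord {N : ℕ} (e : Space N) (x : Sphere N) :
    sphereGrad (polarCoord e) x =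
      (-1 / 2 : ℝ) • (e - (1 - 2 * polarCoord e x) • (x : Space N)) := by
  have h : gradient (polarCoord e) (x : Space N) = (-1 / 2 : ℝ) • e := by
    refine HasGradientAt.gradient ?_
    rw [hasGradientAt_iff_hasFDerivAt]
    have h1 : HasFDerivAt (fun y : Space N => inner ℝ e y) (innerSL ℝ e) (x : Space N) :=
      (innerSL ℝ e).hasFDerivAt
    have h2 : HasFDerivAt (polarCoord e) ((2 : ℝ)⁻¹ • -(innerSL ℝ e)) (x : Space N) := by
      convert! (h1.const_sub 1).const_mul (2 : ℝ)⁻¹ using 1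
      ext y
      simp [polarCoord]
      ring
    convert! h2 using 1
    ext v
    simp
    ring
  rw [sphereGrad, h, polarCoord, inner_smul_right, real_inner_comm]
  rw [smul_sub, smul_smul]
  congr 2
  ring

theorem inner_sphereGrad_polarCoord {N : ℕ} {e : Space N} (he : ‖e‖ = 1) (x : Sphere N) :
    inner ℝ e (sphereGrad (polarCoord e) x) = -2 * (polarCoord e x * (1 - polarCoord e x)) := by
  rw [sphereGrad_polarCoord, inner_smul_right, inner_sub_right, inner_smul_right,
    real_inner_self_eq_norm_sq, he]
  simp only [polarCoord]
  ring

theorem norm_sq_sphereGrad_polarCoord {N : ℕ} {e : Space N} (he : ‖e‖ = 1) (x : Sphere N) :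
    ‖sphereGrad (polarCoord e) x‖ ^ 2 = polarCoord e x * (1 - polarCoord e x) := by
  have h : inner ℝ (sphereGrad (polarCoord e) x) (sphereGrad (polarCoord e) x) =
      (-1 / 2) * inner ℝ e (sphereGrad (polarCoord e) x) := by
    nth_rewrite 1 [sphereGrad_polarCoord]
    rw [inner_smul_left, inner_sub_left, inner_smul_left, inner_self_sphereGrad]
    simp
  rw [← real_inner_self_eq_norm_sq, h, inner_sphereGrad_polarCoord he]
  ring

theorem inner_sphereGrad_polarCoord_sphereGrad {N : ℕ} (e : Space N) (φ : Space N → ℝ)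
    (x : Sphere N) :
    inner ℝ (sphereGrad (polarCoord e) x) (sphereGrad φ x) =
      -1 / 2 * inner ℝ e (sphereGrad φ x) := by
  rw [sphereGrad_polarCoord, inner_smul_left, inner_sub_left, inner_smul_left,
    inner_self_sphereGrad]
  simp

theorem continuous_sphereGrad {N : ℕ} {φ : Space N → ℝ} (hφ : ContDiff ℝ 1 φ) :
    Continuous (sphereGrad φ) := by
  have h : Continuous (gradient φ) :=
    (InnerProductSpace.toDual ℝ (Space N)).symm.continuous.comp (hφ.continuous_fderiv (by simp))
  have h' : Continuous fun x : Sphere N => gradient φ (x : Space N) :=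
    h.comp continuous_subtype_val
  have h2 : Continuous fun x : Sphere N => inner ℝ (x : Space N) (gradient φ (x : Space N)) :=
    continuous_subtype_val.inner h'
  exact h'.sub (h2.smul continuous_subtype_val)

instance {N : ℕ} : IsFiniteMeasure (surface N) :=
  inferInstanceAs (IsFiniteMeasure (volume : Measure (Space N)).toSphere)

instance {N : ℕ} : (surface N).IsOpenPosMeasure :=
  inferInstanceAs ((volume : Measure (Space N)).toSphere).IsOpenPosMeasure

theorem integrable_surface {N : ℕ} {f : Sphere N → ℝ} (hf : Continuous f) :
    Integrable f (surface N) :=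
  hf.integrable_of_hasCompactSupport (HasCompactSupport.of_compactSpace f)

/-- Integration by parts on the sphere against a field that depends on the polar angle only. -/
theorem integral_mul_inner_sphereGrad {d : ℕ} {e : Space (d + 2)} (he : ‖e‖ = 1) {h : ℝ → ℝ}
    (hh : ContDiff ℝ 1 h) {ψ : Space (d + 2) → ℝ} (hψ : ContDiff ℝ 1 ψ) :
    ∫ x, h (polarCoord e x) * inner ℝ e (sphereGrad ψ x) ∂surface (d + 2) =
      ∫ x, ((d + 1) * (1 - 2 * polarCoord e x) * h (polarCoord e x) +
        2 * (polarCoord e x * (1 - polarCoord e x)) * deriv h (polarCoord e x)) * ψ x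
          ∂surface (d + 2) := by
  -- The divergence theorem in direction e is applied to the degree-0 extension of this product.
  set g : Space (d + 2) → ℝ := fun x => h (polarCoord e x) * ψ x with hg
  have hg1 : ContDiff ℝ 1 g := (hh.comp (contDiff_polarCoord e)).mul hψ
  have key := integral_sphere_fderiv (E := Space (d + 2)) (d := d) (by simp) volume
    (η := fun x => g (radialProj x)) (fun r hr x => by simp only [radialProj_smul hr])
    (fun x hx => (hg1.contDiffAt).comp x (contDiffAt_radialProj hx)) e
  have hgrad : ∀ x : Sphere (d + 2), inner ℝ e (sphereGrad g x) =
      h (polarCoord e x) * inner ℝ e (sphereGrad ψ x) -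
        2 * (polarCoord e x * (1 - polarCoord e x)) * deriv h (polarCoord e x) * ψ x := by
    intro x
    have hd1 : DifferentiableAt ℝ (fun y => h (polarCoord e y)) (x : Space (d + 2)) :=
      ((hh.comp (contDiff_polarCoord e)).differentiable (by simp)) _
    have hd2 : DifferentiableAt ℝ ψ (x : Space (d + 2)) := (hψ.differentiable (by simp)) _
    have hmul : sphereGrad g x = h (polarCoord e x) • sphereGrad ψ x +
        ψ x • sphereGrad (fun y => h (polarCoord e y)) x := by
      have : gradient g (x : Space (d + 2)) = h (polarCoord e x) • gradient ψ (x : Space (d + 2)) +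
          ψ x • gradient (fun y => h (polarCoord e y)) (x : Space (d + 2)) := by
        simp only [gradient, hg]
        rw [fderiv_fun_mul hd1 hd2]
        simp
      simp only [sphereGrad, this, inner_add_right, inner_smul_right]
      module
    rw [hmul, sphereGrad_comp x ((hh.differentiable (by simp)) _)
      (((contDiff_polarCoord e).differentiable (n := 1) (by simp)) _), inner_add_right,
      inner_smul_right, inner_smul_right, inner_smul_right, inner_sphereGrad_polarCoord he]
    ring
  have hc : Continuous fun x : Sphere (d + 2) => polarCoord e (x : Space (d + 2)) :=
    (contDiff_polarCoord (n := 0) e).continuous.comp continuous_subtype_val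
  have hψc : Continuous fun x : Sphere (d + 2) => ψ x := hψ.continuous.comp continuous_subtype_val
  have hh' : Continuous (deriv h) := hh.continuous_deriv le_rfl
  have hleft : ∀ x : Sphere (d + 2), fderiv ℝ (fun x => g (radialProj x)) x e =
      h (polarCoord e x) * inner ℝ e (sphereGrad ψ x) -
        2 * (polarCoord e x * (1 - polarCoord e x)) * deriv h (polarCoord e x) * ψ x := fun x => by
    rw [fderiv_comp_radialProj x ((hg1.differentiable (by simp)) _), hgrad x]
  have hright : ∀ x : Sphere (d + 2), inner ℝ (x : Space (d + 2)) e * g (radialProj x) =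
      (1 - 2 * polarCoord e x) * h (polarCoord e x) * ψ x := fun x => by
    have : inner ℝ (x : Space (d + 2)) e = 1 - 2 * polarCoord e x := by
      rw [polarCoord, real_inner_comm]
      ring
    rw [radialProj_of_norm_eq_one (by simp), this]
    simp only [hg]
    ring
  simp only [hleft, hright] at key
  change ∫ x, _ ∂surface (d + 2) = _ * ∫ x, _ ∂surface (d + 2) at key
  rw [integral_sub, ← integral_const_mul, sub_eq_iff_eq_add, ← integral_add] at key
  · rw [key]
    refine integral_congr_ae (ae_of_all _ fun x => ?_)
    simp only
    ring
  · exact integrable_surface (by have := hh.continuous; fun_prop)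
  · exact integrable_surface (by fun_prop)
  · exact integrable_surface ((hh.continuous.comp hc).mul
      (continuous_const.inner (continuous_sphereGrad hψ)))
  · exact integrable_surface (by fun_prop)

/-! ### Smooth extension and truncation of functions of one variable -/

open scoped Manifold in
-- Multiplication by a cutoff turns locally defined functions, such as the power series or F'/F,
-- into global smooth ones. Agreement near each point of K, not only on K, preserves derivatives
-- there.
theorem exists_contDiff_eventuallyEq {U K : Set ℝ} (hU : IsOpen U) (hK : IsCompact K)
    (hKU : K ⊆ U) {h : ℝ → ℝ} (hh : ContDiffOn ℝ ∞ h U) :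
    ∃ g : ℝ → ℝ, ContDiff ℝ ∞ g ∧ ∀ s ∈ K, g =ᶠ[𝓝 s] h := by
  obtain ⟨t, ht, hKt, htU⟩ := exists_compact_between hK hU hKU
  obtain ⟨f, hf1, hf0, -⟩ := exists_contMDiffMap_one_nhds_of_subset_interior (n := ⊤) 𝓘(ℝ, ℝ)
    hK.isClosed hKt
  refine ⟨fun s => f s * h s, contDiff_iff_contDiffAt.2 fun s => ?_, fun s hs => ?_⟩
  · by_cases hs : s ∈ U
    · exact (contMDiff_iff_contDiff.1 f.contMDiff).contDiffAt.mul (hh.contDiffAt (hU.mem_nhds hs))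
    · refine contDiffAt_const (c := (0 : ℝ)).congr_of_eventuallyEq ?_
      filter_upwards [ht.isClosed.isOpen_compl.mem_nhds fun hst => hs (htU hst)] with y hy
      rw [hf0 y hy, zero_mul]
  · filter_upwards [eventually_nhdsSet_iff_forall.1 hf1 s hs] with y hy
    rw [hy, one_mul]

/-- A smooth truncation of the identity, equal to `0` for `(n + 1) y ≤ 1` and to `y` for
`(n + 1) y ≥ 2`. -/
noncomputable def trunc (n : ℕ) (y : ℝ) : ℝ := y * Real.smoothTransition ((n + 1) * y - 1)

/-- The derivative of `trunc n`. -/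
noncomputable def truncDeriv (n : ℕ) (y : ℝ) : ℝ :=
  Real.smoothTransition ((n + 1) * y - 1) +
    (n + 1) * y * deriv Real.smoothTransition ((n + 1) * y - 1)

theorem deriv_smoothTransition_eq_zero {z : ℝ} (hz : z ∉ Set.Ioo (0 : ℝ) 1) :
    deriv Real.smoothTransition z = 0 := by
  by_cases h : 0 < z
  · have h1 : 1 ≤ z := not_lt.1 fun h1 => hz ⟨h, h1⟩
    have hmax : IsLocalMax Real.smoothTransition z := Eventually.of_forall fun y => by
      rw [Real.smoothTransition.one_of_one_le h1]
      exact Real.smoothTransition.le_one y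
    exact hmax.deriv_eq_zero
  · have hmin : IsLocalMin Real.smoothTransition z := Eventually.of_forall fun y => by
      rw [Real.smoothTransition.zero_of_nonpos (not_lt.1 h)]
      exact Real.smoothTransition.nonneg y
    exact hmin.deriv_eq_zero

theorem contDiff_trunc (n : ℕ) : ContDiff ℝ ∞ (trunc n) :=
  contDiff_id.mul ((Real.smoothTransition.contDiff (n := ⊤)).comp
    ((contDiff_const.mul contDiff_id).sub contDiff_const))

theorem hasDerivAt_trunc (n : ℕ) (y : ℝ) : HasDerivAt (trunc n) (truncDeriv n y) y := by
  have h1 : HasDerivAt (fun y : ℝ => (n + 1) * y - 1) (n + 1) y := by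
    simpa using ((hasDerivAt_id y).const_mul ((n : ℝ) + 1)).sub_const 1
  have h2 : HasDerivAt Real.smoothTransition (deriv Real.smoothTransition ((n + 1) * y - 1))
      ((n + 1) * y - 1) :=
    ((Real.smoothTransition.contDiff (n := 1)).differentiable (by simp) _).hasDerivAt
  convert! (hasDerivAt_id y).mul (h2.comp y h1) using 1
  simp [truncDeriv]
  ring

theorem trunc_eq_zero {n : ℕ} {y : ℝ} (h : (n + 1) * y ≤ 1) : trunc n y = 0 := by
  rw [trunc, Real.smoothTransition.zero_of_nonpos (by linarith), mul_zero]

theorem trunc_eq_self {n : ℕ} {y : ℝ} (h : 2 ≤ (n + 1) * y) : trunc n y = y := by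
  rw [trunc, Real.smoothTransition.one_of_one_le (by linarith), mul_one]

theorem truncDeriv_eq_one {n : ℕ} {y : ℝ} (h : 2 ≤ (n + 1) * y) : truncDeriv n y = 1 := by
  rw [truncDeriv, Real.smoothTransition.one_of_one_le (by linarith),
    deriv_smoothTransition_eq_zero fun h' => absurd h'.2 (by linarith), mul_zero, add_zero]

theorem abs_trunc_le (n : ℕ) (y : ℝ) : |trunc n y| ≤ |y| := by
  rw [trunc, abs_mul, abs_of_nonneg (Real.smoothTransition.nonneg _)]
  exact mul_le_of_le_one_right (abs_nonneg y) (Real.smoothTransition.le_one _)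

/-- With z = (n+1) y - 1 the second term is (z + 1) times the derivative of the transition at z, one
compactly supported function independent of n. -/
theorem exists_abs_truncDeriv_le : ∃ C : ℝ, ∀ (n : ℕ) (y : ℝ), |truncDeriv n y| ≤ C := by
  have hcont : Continuous fun z : ℝ => (z + 1) * deriv Real.smoothTransition z :=
    (continuous_id.add continuous_const).mul
      ((Real.smoothTransition.contDiff (n := 1)).continuous_deriv le_rfl)
  have hsupp : HasCompactSupport fun z : ℝ => (z + 1) * deriv Real.smoothTransition z := by
    refine HasCompactSupport.of_support_subset_isCompact (isCompact_Icc (a := (0 : ℝ)) (b := 1)) ?_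
    intro z hz
    by_contra h
    exact hz (by
      simp only
      rw [deriv_smoothTransition_eq_zero fun h' => h ⟨h'.1.le, h'.2.le⟩, mul_zero])
  obtain ⟨C, hC⟩ := hcont.bounded_above_of_compact_support hsupp
  refine ⟨1 + C, fun n y => (abs_add_le _ _).trans (add_le_add ?_ ?_)⟩
  · rw [abs_of_nonneg (Real.smoothTransition.nonneg _)]
    exact Real.smoothTransition.le_one _
  · simpa using hC ((n + 1) * y - 1)

theorem eventually_two_le_mul {y : ℝ} (hy : 0 < y) : ∀ᶠ n : ℕ in atTop, 2 ≤ ((n : ℝ) + 1) * y := by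
  have h : Tendsto (fun n : ℕ => ((n : ℝ) + 1) * y) atTop atTop :=
    (tendsto_atTop_add_const_right _ 1 tendsto_natCast_atTop_atTop).atTop_mul_const hy
  exact h.eventually_ge_atTop 2

/-- The truncation of `F` on `(-∞, σ)`, extended by zero. -/
noncomputable def truncProfile (F : ℝ → ℝ) (σ : ℝ) (n : ℕ) (s : ℝ) : ℝ :=
  if s < σ then trunc n (F s) else 0

theorem truncProfile_of_lt {F : ℝ → ℝ} {σ s : ℝ} (n : ℕ) (hs : s < σ) :
    truncProfile F σ n s = trunc n (F s) := if_pos hs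

theorem truncProfile_of_le {F : ℝ → ℝ} {σ s : ℝ} (n : ℕ) (hs : σ ≤ s) :
    truncProfile F σ n s = 0 := if_neg (not_lt.2 hs)

/-- Near σ the values of F lie below the truncation level. Hence the extension by zero is smooth and
supported strictly inside the cap. -/
theorem truncProfile_eventuallyEq_zero {F : ℝ → ℝ} {σ : ℝ} (hF : Continuous F) (hFσ : F σ = 0)
    (n : ℕ) {s : ℝ} (hs : σ ≤ s) : truncProfile F σ n =ᶠ[𝓝 s] 0 := by
  rcases hs.eq_or_lt with rfl | hs
  · have hlt : (n + 1) * F σ < 1 := by simp [hFσ]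
    filter_upwards [(continuous_const.mul hF).continuousAt.eventually_lt_const hlt] with y hy
    rw [truncProfile]
    split_ifs
    · exact trunc_eq_zero hy.le
    · rfl
  · filter_upwards [eventually_gt_nhds hs] with y hy
    exact truncProfile_of_le n hy.le

theorem truncProfile_eventuallyEq {F : ℝ → ℝ} {σ : ℝ} (n : ℕ) {s : ℝ} (hs : s < σ) :
    truncProfile F σ n =ᶠ[𝓝 s] fun y => trunc n (F y) := by
  filter_upwards [eventually_lt_nhds hs] with y hy
  rw [truncProfile, if_pos hy]

theorem contDiff_truncProfile {F : ℝ → ℝ} {σ : ℝ} (hF : ContDiff ℝ ∞ F) (hFσ : F σ = 0) (n : ℕ) :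
    ContDiff ℝ ∞ (truncProfile F σ n) := by
  refine contDiff_iff_contDiffAt.2 fun s => ?_
  rcases lt_or_ge s σ with hs | hs
  · exact ((contDiff_trunc n).comp hF).contDiffAt.congr_of_eventuallyEq
      (truncProfile_eventuallyEq n hs)
  · exact (contDiffAt_const (c := (0 : ℝ))).congr_of_eventuallyEq
      (truncProfile_eventuallyEq_zero hF.continuous hFσ n hs)

theorem deriv_truncProfile_of_lt {F : ℝ → ℝ} {σ : ℝ} (hF : ContDiff ℝ ∞ F) (n : ℕ) {s : ℝ}
    (hs : s < σ) : deriv (truncProfile F σ n) s = truncDeriv n (F s) * deriv F s := by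
  rw [(truncProfile_eventuallyEq n hs).deriv_eq]
  exact ((hasDerivAt_trunc n (F s)).comp s
    ((hF.differentiable (by simp)) s).hasDerivAt).deriv

theorem deriv_truncProfile_of_le {F : ℝ → ℝ} {σ : ℝ} (hF : Continuous F) (hFσ : F σ = 0) (n : ℕ)
    {s : ℝ} (hs : σ ≤ s) : deriv (truncProfile F σ n) s = 0 := by
  rw [(truncProfile_eventuallyEq_zero hF hFσ n hs).deriv_eq]
  simp

/-! ### Convergence in `L²` -/

section L2

variable {α E : Type*} [MeasurableSpace α] {μ : Measure α} [NormedAddCommGroup E]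

theorem tendsto_eLpNorm_two_of_bounded [IsFiniteMeasure μ] {f : ℕ → α → E} {g : α → E} (C : ℝ)
    (hf : ∀ n, AEStronglyMeasurable (f n) μ) (hg : AEStronglyMeasurable g μ)
    (hC : ∀ n x, ‖f n x - g x‖ ≤ C) (hlim : ∀ x, Tendsto (fun n => f n x) atTop (𝓝 (g x))) :
    Tendsto (fun n => eLpNorm (fun x => f n x - g x) 2 μ) atTop (𝓝 0) := by
  have h : Tendsto (fun n => ∫⁻ x, ‖f n x - g x‖ₑ ^ (2 : ℝ) ∂μ) atTop (𝓝 (∫⁻ _, 0 ∂μ)) := by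
    refine tendsto_lintegral_of_dominated_convergence' (fun _ => ENNReal.ofReal C ^ (2 : ℝ))
      (fun n => ((hf n).sub hg).enorm.pow_const _) (fun n => ae_of_all _ fun x => ?_) ?_
      (ae_of_all _ fun x => ?_)
    · refine ENNReal.rpow_le_rpow ?_ (by norm_num)
      rw [← ofReal_norm]
      exact ENNReal.ofReal_le_ofReal (hC n x)
    · rw [lintegral_const]
      exact ENNReal.mul_ne_top (ENNReal.rpow_ne_top_of_nonneg (by norm_num) ENNReal.ofReal_ne_top)
        (measure_ne_top _ _)
    · have h1 : Tendsto (fun n => f n x - g x) atTop (𝓝 0) := by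
        simpa using (hlim x).sub_const (g x)
      have h2 := h1.enorm
      rw [enorm_zero] at h2
      have h3 := h2.ennrpow_const (2 : ℝ)
      rwa [ENNReal.zero_rpow_of_pos (by norm_num)] at h3
  rw [lintegral_zero] at h
  have h2 := h.ennrpow_const (1 / 2 : ℝ)
  rw [ENNReal.zero_rpow_of_pos (by norm_num)] at h2
  refine h2.congr fun n => ?_
  rw [eLpNorm_eq_lintegral_rpow_enorm_toReal (by norm_num) (by norm_num)]
  simp

variable [InnerProductSpace ℝ E]

theorem inner_toLp {f g : α → E} (hf : MemLp f 2 μ) (hg : MemLp g 2 μ) :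
    inner ℝ (hf.toLp f) (hg.toLp g) = ∫ x, inner ℝ (f x) (g x) ∂μ := by
  rw [L2.inner_def]
  refine integral_congr_ae ?_
  filter_upwards [hf.coeFn_toLp, hg.coeFn_toLp] with x h1 h2
  rw [h1, h2]

theorem tendsto_integral_inner {f : ℕ → α → E} {g k : α → E} (hf : ∀ n, MemLp (f n) 2 μ)
    (hg : MemLp g 2 μ) (hk : MemLp k 2 μ)
    (h : Tendsto (fun n => eLpNorm (fun x => f n x - g x) 2 μ) atTop (𝓝 0)) :
    Tendsto (fun n => ∫ x, inner ℝ (k x) (f n x) ∂μ) atTop (𝓝 (∫ x, inner ℝ (k x) (g x) ∂μ)) := by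
  have hL := (Lp.tendsto_Lp_iff_tendsto_eLpNorm'' f hf g hg).2 h
  have := (tendsto_const_nhds (x := hk.toLp k)).inner (𝕜 := ℝ) hL
  simpa only [inner_toLp] using this

theorem tendsto_integral_norm_sq {f : ℕ → α → E} {g : α → E} (hf : ∀ n, MemLp (f n) 2 μ)
    (hg : MemLp g 2 μ)
    (h : Tendsto (fun n => eLpNorm (fun x => f n x - g x) 2 μ) atTop (𝓝 0)) :
    Tendsto (fun n => ∫ x, ‖f n x‖ ^ 2 ∂μ) atTop (𝓝 (∫ x, ‖g x‖ ^ 2 ∂μ)) := by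
  have hL := (Lp.tendsto_Lp_iff_tendsto_eLpNorm'' f hf g hg).2 h
  have := hL.inner (𝕜 := ℝ) hL
  simp only [inner_toLp] at this
  simpa only [real_inner_self_eq_norm_sq] using this

end L2

/-! ### The first Dirichlet eigenvalue of a spherical cap -/

/-- The cap of the sphere on which `(1 - ⟨e, x⟩) / 2 < σ`. -/
def polarCap {N : ℕ} (e : Space N) (σ : ℝ) : Set (Sphere N) := {x | polarCoord e x < σ}

theorem continuous_polarCoord_sphere {N : ℕ} (e : Space N) :
    Continuous fun x : Sphere N => polarCoord e (x : Space N) :=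
  (contDiff_polarCoord (n := 0) e).continuous.comp continuous_subtype_val

theorem polarCoord_nonneg {N : ℕ} {e : Space N} (he : ‖e‖ = 1) (x : Sphere N) :
    0 ≤ polarCoord e (x : Space N) := by
  have h := real_inner_le_norm e (x : Space N)
  rw [he, norm_eq_of_mem_sphere x] at h
  rw [polarCoord]
  linarith

theorem cap_eq_polarCap {N : ℕ} {e : Space N} (he : ‖e‖ = 1) {γ : ℝ} (h0 : 0 ≤ γ)
    (hπ : γ ≤ Real.pi) : cap e γ = polarCap e ((1 - Real.cos γ) / 2) := by
  ext x
  have hc : Real.cos (InnerProductGeometry.angle e (x : Space N)) = inner ℝ e (x : Space N) := by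
    rw [InnerProductGeometry.cos_angle, he, norm_eq_of_mem_sphere x]
    simp
  have := Real.strictAntiOn_cos.lt_iff_gt (a := γ) (b := InnerProductGeometry.angle e (x : Space N))
    ⟨h0, hπ⟩ ⟨InnerProductGeometry.angle_nonneg _ _, InnerProductGeometry.angle_le_pi _ _⟩
  simp only [cap, polarCap, Set.mem_ofPred_eq, polarCoord, ← hc]
  rw [← this]
  constructor <;> intro h <;> linarith

/-- The support is taken on the sphere only, so φ need not vanish near x in space; its degree-0
extension does. -/
theorem sphereGrad_eq_zero_of_notMem_tsupport {N : ℕ} {φ : Space N → ℝ}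
    (hφ : Differentiable ℝ φ) {x : Sphere N} (hx : x ∉ tsupport fun y : Sphere N => φ y) :
    sphereGrad φ x = 0 := by
  have hx0 : (x : Space N) ≠ 0 := norm_ne_zero_iff.1 (by simp)
  have hclosed : IsClosed ((↑) '' (tsupport fun y : Sphere N => φ y) : Set (Space N)) :=
    ((isClosed_tsupport _).isCompact.image continuous_subtype_val).isClosed
  have hmem : radialProj (x : Space N) ∉ ((↑) '' (tsupport fun y : Sphere N => φ y) : Set _) := by
    rw [radialProj_of_norm_eq_one (by simp)]
    rintro ⟨y, hy, hyx⟩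
    exact hx (Subtype.ext hyx ▸ hy)
  have hev : (fun y => φ (radialProj y)) =ᶠ[𝓝 (x : Space N)] fun _ => 0 := by
    have hcont : ContinuousAt (radialProj : Space N → Space N) x :=
      (contDiffAt_radialProj (n := 0) hx0).continuousAt
    filter_upwards [hcont.preimage_mem_nhds (hclosed.isOpen_compl.mem_nhds hmem),
      isOpen_compl_singleton.mem_nhds hx0] with y hy hy0
    by_contra h
    exact hy ⟨⟨radialProj y, by simpa using norm_radialProj hy0⟩, subset_tsupport _ h, rfl⟩
  refine ext_inner_left ℝ fun v => ?_
  rw [← fderiv_comp_radialProj x (hφ _), hev.fderiv_eq, inner_zero_right]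
  simp

/-- **Picone's inequality** on a cap: a positive radial solution of `-Δ F = l F` on the cap gives
the lower bound `l` for the Dirichlet form. -/
theorem mul_integral_sq_le {d : ℕ} {e : Space (d + 2)} (he : ‖e‖ = 1) {σ l : ℝ} {F : ℝ → ℝ}
    (hF : ContDiff ℝ ∞ F) (hpos : ∀ s, 0 ≤ s → s < σ → 0 < F s)
    (hode : ∀ s, 0 ≤ s → s < σ → s * (1 - s) * deriv (deriv F) s +
      (d + 1) * (1 / 2 - s) * deriv F s + l * F s = 0)
    {φ : Space (d + 2) → ℝ} (hφ : IsTest (polarCap e σ) φ) :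
    l * ∫ x : Sphere (d + 2), φ x ^ 2 ∂surface (d + 2) ≤
      ∫ x, ‖sphereGrad φ x‖ ^ 2 ∂surface (d + 2) := by
  -- The heights reached on the support form a compact set below σ, where F is positive and F'/F is
  -- smooth.
  set K : Set ℝ := (fun x : Sphere (d + 2) => polarCoord e (x : Space (d + 2))) ''
    (tsupport fun x : Sphere (d + 2) => φ x) with hK
  have hKc : IsCompact K := (isClosed_tsupport _).isCompact.image (continuous_polarCoord_sphere e)
  have hKσ : ∀ s ∈ K, 0 ≤ s ∧ s < σ := by
    rintro _ ⟨x, hx, rfl⟩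
    exact ⟨polarCoord_nonneg he x, hφ.2 hx⟩
  have hF' : ContDiff ℝ ∞ (deriv F) := contDiff_infty_iff_deriv.1 hF |>.2
  obtain ⟨h, hh, hhF⟩ := exists_contDiff_eventuallyEq (U := {s | 0 < F s})
    (isOpen_lt continuous_const hF.continuous) hKc (fun s hs => hpos s (hKσ s hs).1 (hKσ s hs).2)
    (h := fun s => deriv F s / F s) (hF'.contDiffOn.div hF.contDiffOn fun s hs => ne_of_gt hs)
  have hφ1 : ContDiff ℝ 1 φ := hφ.1.of_le (by simp)
  have hh1 : ContDiff ℝ 1 h := hh.of_le (by simp)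
  have hibp := integral_mul_inner_sphereGrad he hh1 (hφ1.pow 2)
  have hsq : ∀ x : Sphere (d + 2), sphereGrad (fun y => φ y ^ 2) x =
      (2 * φ x) • sphereGrad φ x := by
    intro x
    rw [sphereGrad_comp (Φ := fun y => y ^ 2) x (by fun_prop) ((hφ1.differentiable (by simp)) _)]
    simp
  -- Half of the integration-by-parts identity for φ² is added, since it integrates to zero. With it
  -- the claim is |∇φ - φ h ∇s|² ≥ 0, where s is the polar coordinate.
  have hpt : ∀ x : Sphere (d + 2), l * φ x ^ 2 ≤ ‖sphereGrad φ x‖ ^ 2 +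
      (h (polarCoord e x) * inner ℝ e (sphereGrad (fun y => φ y ^ 2) x) -
        ((d + 1) * (1 - 2 * polarCoord e x) * h (polarCoord e x) +
        2 * (polarCoord e x * (1 - polarCoord e x)) * deriv h (polarCoord e x)) * φ x ^ 2) / 2 := by
    intro x
    by_cases hx : x ∈ tsupport fun x : Sphere (d + 2) => φ x
    · have hsK : polarCoord e (x : Space (d + 2)) ∈ K := ⟨x, hx, rfl⟩
      obtain ⟨hs0, hsσ⟩ := hKσ _ hsK
      have hFs := hpos _ hs0 hsσ
      have ho := hode _ hs0 hsσ
      have hev := hhF _ hsK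
      have e1 := hev.eq_of_nhds
      have e2 := hev.deriv_eq
      have hn : 0 ≤ ‖sphereGrad φ x -
          (φ x * h (polarCoord e x)) • sphereGrad (polarCoord e) x‖ ^ 2 :=
        sq_nonneg _
      rw [norm_sub_sq_real, inner_smul_right, norm_smul, mul_pow, norm_sq_sphereGrad_polarCoord he,
        real_inner_comm, inner_sphereGrad_polarCoord_sphereGrad, Real.norm_eq_abs, sq_abs] at hn
      rw [hsq, inner_smul_right]
      rw [deriv_fun_div (hF'.differentiable (by simp) _) (hF.differentiable (by simp) _)
        hFs.ne'] at e2
      set s := polarCoord e (x : Space (d + 2))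
      -- The Riccati equation of the logarithmic derivative h = F'/F.
      have hl : l = -((d + 1) * (1 / 2 - s) * h s + s * (1 - s) * (deriv h s + h s ^ 2)) := by
        rw [e2, e1]
        field_simp
        linear_combination 2 * F s * ho
      have hl2 : l * φ x ^ 2 =
          -((d + 1) * (1 / 2 - s) * h s + s * (1 - s) * (deriv h s + h s ^ 2)) * φ x ^ 2 := by
        rw [← hl]
      rw [hl2]
      linarith
    · have h0 : φ x = 0 :=
        image_eq_zero_of_notMem_tsupport (f := fun y : Sphere (d + 2) => φ y) hx
      simp [hsq, h0]
  have hc := continuous_polarCoord_sphere e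
  have hφc : Continuous fun x : Sphere (d + 2) => φ x := hφ1.continuous.comp continuous_subtype_val
  have hhc := hh1.continuous
  have hhc' : Continuous (deriv h) := hh1.continuous_deriv le_rfl
  have hgc : Continuous fun x => ‖sphereGrad φ x‖ ^ 2 := (continuous_sphereGrad hφ1).norm.pow 2
  have hAc : Continuous fun x : Sphere (d + 2) => h (polarCoord e x) *
      inner ℝ e (sphereGrad (fun y => φ y ^ 2) x) :=
    (hhc.comp hc).mul (continuous_const.inner (continuous_sphereGrad (hφ1.pow 2)))
  have hBc : Continuous fun x : Sphere (d + 2) => ((d + 1) * (1 - 2 * polarCoord e x) *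
      h (polarCoord e x) + 2 * (polarCoord e x * (1 - polarCoord e x)) *
        deriv h (polarCoord e x)) * φ x ^ 2 := by fun_prop
  have hABc : Continuous fun x : Sphere (d + 2) =>
      (h (polarCoord e x) * inner ℝ e (sphereGrad (fun y => φ y ^ 2) x) -
        ((d + 1) * (1 - 2 * polarCoord e x) * h (polarCoord e x) +
        2 * (polarCoord e x * (1 - polarCoord e x)) * deriv h (polarCoord e x)) * φ x ^ 2) / 2 :=
    (hAc.sub hBc).div_const 2
  calc l * ∫ x : Sphere (d + 2), φ x ^ 2 ∂surface (d + 2)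
      = ∫ x : Sphere (d + 2), l * φ x ^ 2 ∂surface (d + 2) := (integral_const_mul _ _).symm
    _ ≤ ∫ x : Sphere (d + 2), (‖sphereGrad φ x‖ ^ 2 +
        (h (polarCoord e x) * inner ℝ e (sphereGrad (fun y => φ y ^ 2) x) -
        ((d + 1) * (1 - 2 * polarCoord e x) * h (polarCoord e x) +
        2 * (polarCoord e x * (1 - polarCoord e x)) * deriv h (polarCoord e x)) * φ x ^ 2) / 2)
          ∂surface (d + 2) := integral_mono (integrable_surface (by fun_prop))
        (integrable_surface (hgc.add hABc)) hpt
    _ = ∫ x, ‖sphereGrad φ x‖ ^ 2 ∂surface (d + 2) := by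
        rw [integral_add (integrable_surface hgc) (integrable_surface hABc),
          integral_div, integral_sub (integrable_surface hAc) (integrable_surface hBc), hibp]
        simp

theorem memLp_surface {N : ℕ} {E : Type*} [NormedAddCommGroup E] {f : Sphere N → E}
    (hf : Continuous f) : MemLp f 2 (surface N) :=
  hf.memLp_of_hasCompactSupport (HasCompactSupport.of_compactSpace f)

/-- A lower bound for the Dirichlet form on test functions is a lower bound for the Dirichlet
eigenvalues. -/
theorem le_of_isDirichletEigenvalue {N : ℕ} {D : Set (Sphere N)} {l m : ℝ}
    (hl : ∀ φ, IsTest D φ → l * ∫ x : Sphere N, φ x ^ 2 ∂surface N ≤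
      ∫ x, ‖sphereGrad φ x‖ ^ 2 ∂surface N) (hm : IsDirichletEigenvalue D m) : l ≤ m := by
  obtain ⟨u, G, ⟨hu, hG, φ, hφ, hφu, hφG⟩, hu0, hweak⟩ := hm
  have hφ1 : ∀ n, ContDiff ℝ 1 (φ n) := fun n => (hφ n).1.of_le (by simp)
  have hφm : ∀ n, MemLp (fun x : Sphere N => φ n x) 2 (surface N) := fun n =>
    memLp_surface ((hφ1 n).continuous.comp continuous_subtype_val)
  have hGm : ∀ n, MemLp (sphereGrad (φ n)) 2 (surface N) := fun n =>
    memLp_surface (continuous_sphereGrad (hφ1 n))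
  have t1 := tendsto_integral_norm_sq hφm hu hφu
  have t2 := tendsto_integral_norm_sq hGm hG hφG
  have t3 := tendsto_integral_inner hφm hu hu hφu
  have t4 := tendsto_integral_inner hGm hG hG hφG
  simp only [Real.norm_eq_abs, sq_abs] at t1
  have hinner : ∀ n, ∫ x, inner ℝ (u x) (φ n x) ∂surface N = ∫ x, u x * φ n x ∂surface N :=
    fun n => integral_congr_ae (ae_of_all _ fun x => by simp [mul_comm])
  have hinner' : ∫ x, inner ℝ (u x) (u x) ∂surface N = ∫ x, u x ^ 2 ∂surface N :=
    integral_congr_ae (ae_of_all _ fun x => by simp)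
  simp only [real_inner_self_eq_norm_sq] at t4
  rw [hinner'] at t3
  simp only [hinner] at t3
  -- The eigenfunction is tested against itself through its approximating test functions.
  have heq : ∫ x, ‖G x‖ ^ 2 ∂surface N = m * ∫ x, u x ^ 2 ∂surface N := by
    refine tendsto_nhds_unique t4 ((t3.const_mul m).congr fun n => ?_)
    rw [hweak (φ n) (hφ n)]
  have hle : l * ∫ x, u x ^ 2 ∂surface N ≤ m * ∫ x, u x ^ 2 ∂surface N := by
    rw [← heq]
    exact le_of_tendsto_of_tendsto' (t1.const_mul l) t2 fun n => hl (φ n) (hφ n)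
  have hint : Integrable (fun x => u x ^ 2) (surface N) := hu.integrable_sq
  have hpos : 0 < ∫ x, u x ^ 2 ∂surface N := by
    refine (integral_nonneg fun x => sq_nonneg _).lt_of_ne fun h => hu0 ?_
    have := (integral_eq_zero_iff_of_nonneg (fun x => sq_nonneg _) hint).1 h.symm
    filter_upwards [this] with x hx
    simpa using hx
  exact le_of_mul_le_mul_right hle hpos

/-- A radial solution of `-Δ F = l F` that is positive inside the cap and vanishes on its boundary
is a Dirichlet eigenfunction. -/
theorem isDirichletEigenvalue_polarCap {d : ℕ} {e : Space (d + 2)} (he : ‖e‖ = 1) {σ l : ℝ}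
    (hσ : 0 < σ) {F : ℝ → ℝ} (hF : ContDiff ℝ ∞ F) (hpos : ∀ s, 0 ≤ s → s < σ → 0 < F s)
    (hFσ : F σ = 0)
    (hode : ∀ s, 0 ≤ s → s < σ → s * (1 - s) * deriv (deriv F) s +
      (d + 1) * (1 / 2 - s) * deriv F s + l * F s = 0) :
    IsDirichletEigenvalue (polarCap e σ) l := by
  set D := polarCap e σ with hD
  have hc := continuous_polarCoord_sphere e
  have hDo : IsOpen D := isOpen_lt hc continuous_const
  have hDm : MeasurableSet D := hDo.measurableSet
  have hs1 : ContDiff ℝ ∞ (polarCoord e) := contDiff_polarCoord e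
  have hF' : ContDiff ℝ ∞ (deriv F) := contDiff_infty_iff_deriv.1 hF |>.2
  set w : Sphere (d + 2) → ℝ := fun x => F (polarCoord e x) with hw
  set W : Sphere (d + 2) → Space (d + 2) := fun x =>
    deriv F (polarCoord e x) • sphereGrad (polarCoord e) x with hW
  have hwc : Continuous w := hF.continuous.comp hc
  have hWc : Continuous W :=
    (hF'.continuous.comp hc).smul (continuous_sphereGrad (hs1.of_le (by simp)))
  have hgradn : ∀ (n : ℕ) (x : Sphere (d + 2)),
      sphereGrad (fun y => truncProfile F σ n (polarCoord e y)) x =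
        deriv (truncProfile F σ n) (polarCoord e x) • sphereGrad (polarCoord e) x := fun n x =>
    sphereGrad_comp x ((contDiff_truncProfile hF hFσ n).differentiable (by simp) _)
      (hs1.differentiable (by simp) _)
  have htest : ∀ n, IsTest D fun y => truncProfile F σ n (polarCoord e y) := by
    intro n
    refine ⟨(contDiff_truncProfile hF hFσ n).comp hs1, fun x hx => ?_⟩
    by_contra hxD
    refine notMem_tsupport_iff_eventuallyEq.2 ?_ hx
    exact hc.continuousAt.eventually
      (truncProfile_eventuallyEq_zero hF.continuous hFσ n (not_lt.1 hxD))
  obtain ⟨C₁, hC₁⟩ := hwc.bounded_above_of_compact_support (HasCompactSupport.of_compactSpace w)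
  obtain ⟨C₂, hC₂⟩ := hWc.bounded_above_of_compact_support (HasCompactSupport.of_compactSpace W)
  obtain ⟨C₃, hC₃⟩ := exists_abs_truncDeriv_le
  have x₀ : Sphere (d + 2) := ⟨e, by simpa using he⟩
  have hC₁0 : 0 ≤ C₁ := (norm_nonneg _).trans (hC₁ x₀)
  have hC₂0 : 0 ≤ C₂ := (norm_nonneg _).trans (hC₂ x₀)
  have hC₃0 : 0 ≤ C₃ := (abs_nonneg _).trans (hC₃ 0 0)
  -- The eigenfunction is the radial solution cut off to the cap. Its truncations converge pointwise
  -- and boundedly, values and gradients alike, hence in L².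
  refine ⟨D.indicator w, D.indicator W, ⟨(memLp_surface hwc).indicator hDm,
    (memLp_surface hWc).indicator hDm, fun n y => truncProfile F σ n (polarCoord e y), htest,
    ?_, ?_⟩, ?_, ?_⟩
  · refine tendsto_eLpNorm_two_of_bounded (C₁ + C₁) (fun n => ?_)
      (hwc.aestronglyMeasurable.indicator hDm) (fun n x => ?_) fun x => ?_
    · exact ((htest n).1.continuous.comp continuous_subtype_val).aestronglyMeasurable
    · by_cases hx : x ∈ D
      · simp only [Set.indicator_of_mem hx]
        rw [truncProfile_of_lt n hx]
        refine (norm_sub_le _ _).trans (add_le_add ?_ (hC₁ x))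
        exact (abs_trunc_le n _).trans (hC₁ x)
      · simp only [Set.indicator_of_notMem hx]
        rw [truncProfile_of_le n (not_lt.1 hx)]
        simpa using hC₁0
    · by_cases hx : x ∈ D
      · rw [Set.indicator_of_mem hx]
        refine tendsto_const_nhds.congr' ?_
        filter_upwards [eventually_two_le_mul (hpos _ (polarCoord_nonneg he x) hx)] with n hn
        rw [truncProfile_of_lt n hx, trunc_eq_self hn]
      · rw [Set.indicator_of_notMem hx]
        exact tendsto_const_nhds.congr fun n => (truncProfile_of_le n (not_lt.1 hx)).symm
  · refine tendsto_eLpNorm_two_of_bounded (C₃ * C₂ + C₂) (fun n => ?_)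
      (hWc.aestronglyMeasurable.indicator hDm) (fun n x => ?_) fun x => ?_
    · exact (continuous_sphereGrad ((htest n).1.of_le (by simp))).aestronglyMeasurable
    · rw [hgradn]
      by_cases hx : x ∈ D
      · rw [Set.indicator_of_mem hx, deriv_truncProfile_of_lt hF n hx, mul_smul]
        refine (norm_sub_le _ _).trans (add_le_add ?_ (hC₂ x))
        rw [norm_smul]
        exact mul_le_mul (hC₃ n _) (hC₂ x) (norm_nonneg _) hC₃0
      · rw [Set.indicator_of_notMem hx, deriv_truncProfile_of_le hF.continuous hFσ n (not_lt.1 hx)]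
        simp only [zero_smul, sub_zero, norm_zero]
        positivity
    · by_cases hx : x ∈ D
      · rw [Set.indicator_of_mem hx]
        refine tendsto_const_nhds.congr' ?_
        filter_upwards [eventually_two_le_mul (hpos _ (polarCoord_nonneg he x) hx)] with n hn
        rw [hgradn, deriv_truncProfile_of_lt hF n hx, truncDeriv_eq_one hn, one_mul]
      · rw [Set.indicator_of_notMem hx]
        refine tendsto_const_nhds.congr fun n => ?_
        rw [hgradn, deriv_truncProfile_of_le hF.continuous hFσ n (not_lt.1 hx), zero_smul]
  · intro hzero
    have hsub : D ⊆ {x | ¬ D.indicator w x = (0 : Sphere (d + 2) → ℝ) x} := fun x hx => by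
      simp only [Set.mem_ofPred_eq, Set.indicator_of_mem hx, Pi.zero_apply]
      exact (hpos _ (polarCoord_nonneg he x) hx).ne'
    have hne : D.Nonempty := ⟨⟨e, by simpa using he⟩, by
      simp only [hD, polarCap, Set.mem_ofPred_eq, polarCoord, real_inner_self_eq_norm_sq, he]
      simpa using hσ⟩
    exact (hDo.measure_pos (surface (d + 2)) hne).ne' (measure_mono_null hsub (ae_iff.1 hzero))
  · intro ψ hψ
    have hψ1 : ContDiff ℝ 1 ψ := hψ.1.of_le (by simp)
    have h1 : ∀ x, inner ℝ (D.indicator W x) (sphereGrad ψ x) =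
        -1 / 2 * (deriv F (polarCoord e x) * inner ℝ e (sphereGrad ψ x)) := by
      intro x
      by_cases hx : x ∈ D
      · rw [Set.indicator_of_mem hx, hW, real_inner_smul_left,
          inner_sphereGrad_polarCoord_sphereGrad]
        ring
      · rw [sphereGrad_eq_zero_of_notMem_tsupport (hψ1.differentiable (by simp))
          fun h => hx (hψ.2 h)]
        simp
    -- The ODE is needed only inside the cap, since ψ vanishes outside; there both integrands match
    -- those of the integration by parts with h = F'.
    have h2 : ∀ x : Sphere (d + 2), l * (D.indicator w x * ψ x) =
        -1 / 2 * (((d + 1) * (1 - 2 * polarCoord e x) * deriv F (polarCoord e x) +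
          2 * (polarCoord e x * (1 - polarCoord e x)) *
            deriv (deriv F) (polarCoord e x)) * ψ x) := by
      intro x
      by_cases hx : x ∈ D
      · rw [Set.indicator_of_mem hx, hw]
        linear_combination ψ x * hode _ (polarCoord_nonneg he x) hx
      · have h0 : ψ x = 0 :=
          image_eq_zero_of_notMem_tsupport (f := fun y : Sphere (d + 2) => ψ y)
            fun h => hx (hψ.2 h)
        simp [h0]
    rw [← integral_const_mul]
    simp only [h1, h2]
    rw [integral_const_mul, integral_const_mul,
      integral_mul_inner_sphereGrad he (hF'.of_le (by simp)) hψ1]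

end SphereDirichlet

/-! ### The two-sided bound -/

theorem theorem3p3 (N : ℕ) (hN : 3 ≤ N) (γ : ℝ) (hγ : 0 < γ) (hγπ : γ < Real.pi) :
    ∃ B₁ l₁ : ℝ,
      SphereDirichlet.IsFirstBesselZero (((N : ℝ) - 3) / 2) B₁ ∧
      SphereDirichlet.IsFirstDirichletEigenvalue
        (SphereDirichlet.cap (EuclideanSpace.single (⟨N - 1, by omega⟩ : Fin N) (1 : ℝ)) γ) l₁ ∧
      (Real.sin γ / γ) ^ (N - 2) * (B₁ / γ) ^ 2 ≤ l₁ ∧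
      l₁ ≤ (γ / Real.sin γ) ^ (N - 2) * (B₁ / γ) ^ 2 := by
  open SphereDirichlet in
  obtain ⟨M, rfl⟩ : ∃ M, N = M + 2 := ⟨N - 2, by omega⟩
  obtain ⟨B, hB, hBfirst, hB0, hBpos⟩ := exists_isFirstBesselZero M (by omega)
  obtain ⟨l, hlpos, hl0, hlow, hup⟩ := exists_capProfile_first_zero M hγ hγπ hB hB0 hBpos
  set e : Space (M + 2) := EuclideanSpace.single (⟨M + 2 - 1, by omega⟩ : Fin (M + 2)) (1 : ℝ)
    with he_def
  have he : ‖e‖ = 1 := by simp [he_def]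
  set σ : ℝ := (1 - Real.cos γ) / 2 with hσ
  have hσ1 : σ < 1 := (abs_lt.1 (abs_half_one_sub_cos_lt hγ.le hγπ)).2
  have hσ0 : 0 < σ := by
    have := Real.cos_lt_cos_of_nonneg_of_le_pi le_rfl hγπ.le hγ
    rw [Real.cos_zero] at this
    rw [hσ]
    linarith
  -- The series is smooth only on (-1, 1); F is a global smooth function equal to it near every
  -- point of [0, σ], where σ < 1.
  obtain ⟨F, hF, hFeq⟩ := exists_contDiff_eventuallyEq (U := Set.Ioo (-1) 1) isOpen_Ioo
    (isCompact_Icc (a := 0) (b := σ)) (fun s hs => ⟨by linarith [hs.1], hs.2.trans_lt hσ1⟩)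
    (contDiffOn_powerSum (convergesOn_capCoeff M l))
  have hFpos : ∀ s, 0 ≤ s → s < σ → 0 < F s := by
    intro s hs0 hsσ
    rw [(hFeq s ⟨hs0, hsσ.le⟩).eq_of_nhds]
    -- Height s corresponds to the angle arccos (1 - 2s), which is below γ when s < σ.
    have hcos : Real.cos (Real.arccos (1 - 2 * s)) = 1 - 2 * s :=
      Real.cos_arccos (by linarith) (by linarith)
    have hlt : Real.arccos (1 - 2 * s) < γ := by
      refine (Real.strictAntiOn_cos.lt_iff_gt ⟨hγ.le, hγπ.le⟩
        ⟨Real.arccos_nonneg _, Real.arccos_le_pi _⟩).1 ?_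
      rw [hcos]
      linarith
    have := hlpos _ (Real.arccos_nonneg _) hlt
    rwa [hcos, show (1 - (1 - 2 * s)) / 2 = s by ring] at this
  have hFσ : F σ = 0 := by
    rw [(hFeq σ ⟨hσ0.le, le_rfl⟩).eq_of_nhds]
    exact hl0
  have hode : ∀ s, 0 ≤ s → s < σ → s * (1 - s) * deriv (deriv F) s +
      (M + 1) * (1 / 2 - s) * deriv F s + l * F s = 0 := by
    intro s hs0 hsσ
    have hev : F =ᶠ[nhds s] capProfile M l := hFeq s ⟨hs0, hsσ.le⟩
    rw [hev.deriv.deriv_eq, hev.deriv_eq, hev.eq_of_nhds]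
    exact capProfile_ode M l (abs_lt.2 ⟨by linarith, by linarith⟩)
  refine ⟨B, l, ?_, ?_, hlow, hup⟩
  · convert! hBfirst using 1
    push_cast
    ring
  · rw [cap_eq_polarCap he hγ.le hγπ.le]
    exact ⟨isDirichletEigenvalue_polarCap he hσ0 hF hFpos hFσ hode, fun m hm =>
      le_of_isDirichletEigenvalue (fun φ hφ => mul_integral_sq_le he hF hFpos hode hφ) hm⟩
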